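/- Let $\overline{\mathbb C}=\mathbb C\cup\{\infty\}$ be the Riemann sphere with the spherical (great circle) distance, and let $\overline{\mathbb C^2}=\mathbb C^2\cup\{\infty_2\}$ be the one-point compactification of $\mathbb C^2$. For $a_n\in\mathbb C$ and $\epsilon_n>0$ $(n\ge 1)$ let $f_n$ be the rational shear $$f_n(x,y)=\Bigl(x,\;y+\frac{\epsilon_n}{x-a_n}\Bigr)\ (n\text{ odd}),\qquad f_n(x,y)=\Bigl(x+\frac{\epsilon_n}{y-a_n},\;y\Bigr)\ (n\text{ even}),$$ where the polar line and $\infty_2$ are sent to $\infty_2$. Put $\gamma_n(z)=f_n\circ\dots\circ f_1(z,0)$ for $z\in\mathbb C$ and $\gamma_n(\infty)=\infty_2$. For $R_n>0$ put $B_n=\{(x,y)\in\mathbb C^2:|x|\le R_n,\ |y|\le R_n\}$ and $\Delta_n=\gamma_n^{-1}(\overline{\mathbb C^2}\setminus B_n)\subset\overline{\mathbb C}$. Let $b_n=k_{n+1}$, where $k_0=k_1=1$ and $k_{n+2}=k_{n+1}+k_n$. **Theorem.** There are a Cantor set $C\subset\overline{\mathbb C}$ (a subset homeomorphic to the ternary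 Cantor set) with $\dim_H C=0$ and a proper holomorphic embedding $\gamma\colon\overline{\mathbb C}\setminus C\hookrightarrow\mathbb C^2$. Moreover, they can be obtained as follows: there are parameters $a_n\in\mathbb C$ and $\epsilon_n>0$ $(n\ge1)$ and $R_n>0$ $(n\ge0)$, with $(\epsilon_n)$ strictly decreasing to $0$, $(R_n)$ strictly increasing to $+\infty$ and $R_{n-1}<|a_n|<R_n$ for all $n\ge1$, such that 1. $C=\bigcap_{n\ge1}\Delta_n$; 2. for every $n\ge1$ the set $\gamma_n^{-1}(\infty_2)$ has exactly $b_n$ points and is contained in $C$, the set $\Delta_n$ is open, each connected component of $\Delta_n$ contains exactly one point of $\gamma_n^{-1}(\infty_2)$ (so there are $b_n$ components), and each component has spherical diameter less than $1/b_n^{\,n}$; 3. $\gamma_n\to\gamma$ locally uniformly on $\overline{\mathbb C}\setminus C$ (where every $\gamma_n$ takes values in $\mathbb C^2$ for $n\ge1$, by 2). -/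

import Mathlib

open Set Filter Topology OnePoint

noncomputable section

namespace RiemannSphere

/-- Stereographic parametrisation of the unit sphere of `ℝ³` by the Riemann sphere `ℂ ∪ {∞}`. -/
def stereo : OnePoint ℂ → EuclideanSpace ℝ (Fin 3)
  | ∞ => !₂[0, 0, 1]
  | (z : ℂ) => !₂[2 * z.re / (‖z‖ ^ 2 + 1), 2 * z.im / (‖z‖ ^ 2 + 1),
      (‖z‖ ^ 2 - 1) / (‖z‖ ^ 2 + 1)]

/-- The spherical (great circle) distance on the Riemann sphere. -/
def sphDist (x y : OnePoint ℂ) : ℝ := Real.arccos (inner ℝ (stereo x) (stereo y))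

lemma stereo_infty : stereo ∞ = !₂[0, 0, 1] := rfl

lemma stereo_coe (z : ℂ) : stereo z = !₂[2 * z.re / (‖z‖ ^ 2 + 1), 2 * z.im / (‖z‖ ^ 2 + 1),
      (‖z‖ ^ 2 - 1) / (‖z‖ ^ 2 + 1)] := rfl

lemma norm_stereo (x : OnePoint ℂ) : ‖stereo x‖ = 1 := by
  induction x using OnePoint.rec with
  | infty => simp [stereo_infty, EuclideanSpace.norm_eq, Fin.sum_univ_three]
  | coe z =>
    have h : ‖z‖ ^ 2 = z.re ^ 2 + z.im ^ 2 := by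
      rw [Complex.sq_norm, Complex.normSq_apply]; ring
    have h0 : (‖z‖ ^ 2 + 1) ≠ 0 := by positivity
    rw [stereo_coe, EuclideanSpace.norm_eq, Real.sqrt_eq_one]
    simp only [Fin.sum_univ_three, Real.norm_eq_abs, sq_abs]
    simp only [Matrix.cons_val]
    field_simp
    rw [h]; ring

lemma stereo_injective : Function.Injective stereo := by
  intro x y hxy
  have h2 := congrArg (fun v : EuclideanSpace ℝ (Fin 3) => v 2) hxy
  have h0 := congrArg (fun v : EuclideanSpace ℝ (Fin 3) => v 0) hxy
  have h1 := congrArg (fun v : EuclideanSpace ℝ (Fin 3) => v 1) hxy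
  induction x using OnePoint.rec with
  | infty =>
    induction y using OnePoint.rec with
    | infty => rfl
    | coe w =>
      exfalso
      simp only [stereo_infty, stereo_coe, Matrix.cons_val] at h2
      have : (‖w‖ ^ 2 + 1) ≠ 0 := by positivity
      field_simp at h2
      linarith
  | coe z =>
    induction y using OnePoint.rec with
    | infty =>
      exfalso
      simp only [stereo_infty, stereo_coe, Matrix.cons_val] at h2
      have : (‖z‖ ^ 2 + 1) ≠ 0 := by positivity
      field_simp at h2
      linarith
    | coe w =>
      simp only [stereo_coe, Matrix.cons_val] at h0 h1 h2
      have hz : (‖z‖ ^ 2 + 1) ≠ 0 := by positivity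
      have hw : (‖w‖ ^ 2 + 1) ≠ 0 := by positivity
      have e : ‖z‖ ^ 2 = ‖w‖ ^ 2 := by
        field_simp at h2
        linarith
      rw [e] at h0 h1
      field_simp at h0 h1
      exact congrArg _ (Complex.ext h0 h1)

lemma continuous_stereo : Continuous stereo := by
  rw [OnePoint.continuous_iff]
  refine ⟨?_, ?_⟩
  · rw [coclosedCompact_eq_cocompact, stereo_infty]
    have hn : Tendsto (fun z : ℂ => ‖z‖) (cocompact ℂ) atTop := tendsto_norm_cocompact_atTop
    have hr : Tendsto (fun z : ℂ => 2 / (‖z‖ + ‖z‖⁻¹)) (cocompact ℂ) (𝓝 0) :=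
      Tendsto.const_div_atTop
        (tendsto_atTop_mono (fun z => le_add_of_nonneg_right (by positivity)) hn) 2
    have key : ∀ (z : ℂ) (t : ℝ), |t| ≤ ‖z‖ →
        ‖2 * t / (‖z‖ ^ 2 + 1)‖ ≤ 2 / (‖z‖ + ‖z‖⁻¹) := by
      intro z t ht
      rcases eq_or_ne z 0 with rfl | hz
      · have : t = 0 := by simpa using ht
        simp [this]
      · have hz' : 0 < ‖z‖ := norm_pos_iff.2 hz
        rw [Real.norm_eq_abs, abs_div, abs_mul, abs_of_pos (show (0:ℝ) < ‖z‖ ^ 2 + 1 by positivity),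
          abs_of_pos (show (0:ℝ) < 2 by norm_num), div_le_div_iff₀ (by positivity) (by positivity)]
        have : ‖z‖ * (‖z‖ + ‖z‖⁻¹) = ‖z‖ ^ 2 + 1 := by field_simp
        rw [← this, ← mul_assoc]
        gcongr
    have hs : Tendsto (fun z : ℂ => ‖z‖ ^ 2 + 1) (cocompact ℂ) atTop :=
      tendsto_atTop_add_const_right _ _ ((tendsto_pow_atTop two_ne_zero).comp hn)
    have h3 : Tendsto (fun z : ℂ => (‖z‖ ^ 2 - 1) / (‖z‖ ^ 2 + 1)) (cocompact ℂ) (𝓝 1) := by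
      have := (tendsto_const_nhds (x := (1:ℝ))).sub (Tendsto.const_div_atTop hs 2)
      rw [sub_zero] at this
      refine this.congr fun z => ?_
      have : (‖z‖ ^ 2 + 1) ≠ 0 := by positivity
      field_simp
      ring
    refine ((PiLp.continuous_toLp 2 _).tendsto _).comp (tendsto_pi_nhds.2 fun i => ?_)
    fin_cases i
    · exact squeeze_zero_norm (fun z => key z _ (Complex.abs_re_le_norm z)) hr
    · exact squeeze_zero_norm (fun z => key z _ (Complex.abs_im_le_norm z)) hr
    · exact h3
  · refine (PiLp.continuous_toLp 2 _).comp (continuous_pi fun i => ?_)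
    have hz : ∀ z : ℂ, (‖z‖ ^ 2 + 1) ≠ 0 := fun z => by positivity
    fin_cases i
    · exact (continuous_const.mul Complex.continuous_re).div (by fun_prop) hz
    · exact (continuous_const.mul Complex.continuous_im).div (by fun_prop) hz
    · exact Continuous.div (by fun_prop) (by fun_prop) hz

lemma sphDist_eq_angle (x y : OnePoint ℂ) :
    sphDist x y = InnerProductGeometry.angle (stereo x) (stereo y) := by
  simp [sphDist, InnerProductGeometry.angle, norm_stereo]

lemma sphDist_self (x : OnePoint ℂ) : sphDist x x = 0 := by
  rw [sphDist, real_inner_self_eq_norm_sq, norm_stereo]; simp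

lemma sphDist_comm (x y : OnePoint ℂ) : sphDist x y = sphDist y x := by
  rw [sphDist, sphDist, real_inner_comm]

lemma sphDist_triangle (x y z : OnePoint ℂ) : sphDist x z ≤ sphDist x y + sphDist y z := by
  simp only [sphDist_eq_angle]
  exact InnerProductGeometry.angle_le_angle_add_angle _ _ _

lemma eq_of_sphDist_eq_zero {x y : OnePoint ℂ} (h : sphDist x y = 0) : x = y := by
  rw [sphDist, Real.arccos_eq_zero] at h
  apply stereo_injective
  have := real_inner_le_norm (stereo x) (stereo y)
  rw [norm_stereo, norm_stereo, mul_one] at this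
  exact (inner_eq_one_iff_of_norm_eq_one (norm_stereo x) (norm_stereo y)).1 (le_antisymm this h)

/-- A copy of the Riemann sphere, used only to state that the spherical distance is a metric. -/
def SphCopy : Type := OnePoint ℂ

instance : MetricSpace SphCopy where
  dist := sphDist
  dist_self := sphDist_self
  dist_comm := sphDist_comm
  dist_triangle := sphDist_triangle
  eq_of_dist_eq_zero := eq_of_sphDist_eq_zero

/-- The identity map from the Riemann sphere to its copy. -/
def toSphCopy : OnePoint ℂ → SphCopy := id

/-- The spherical distance induces the topology of the one point compactification. -/
lemma isEmbedding_toSphCopy : IsEmbedding toSphCopy := by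
  have hc : Continuous toSphCopy := by
    rw [continuous_iff_continuousAt]
    intro x
    rw [ContinuousAt, tendsto_iff_dist_tendsto_zero]
    have h : Continuous fun y => sphDist y x :=
      Real.continuous_arccos.comp (continuous_stereo.inner continuous_const)
    have h' := h.tendsto x
    rwa [show sphDist x x = 0 from dist_self (toSphCopy x)] at h'
  exact (hc.isClosedEmbedding fun _ _ h => h).isEmbedding

/-- The Riemann sphere with the spherical distance; its topology is that of `OnePoint ℂ`. -/
abbrev sphMetric : MetricSpace (OnePoint ℂ) := isEmbedding_toSphCopy.comapMetricSpace toSphCopy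

lemma sphMetric_dist (x y : OnePoint ℂ) : sphMetric.dist x y = sphDist x y := rfl

/-- Diameter of a subset of the Riemann sphere for the spherical distance. -/
def sphDiam (s : Set (OnePoint ℂ)) : ℝ := @Metric.diam _ sphMetric.toPseudoMetricSpace s

/-- Hausdorff dimension of a subset of the Riemann sphere for the spherical distance. -/
def sphDimH (s : Set (OnePoint ℂ)) : ENNReal :=
  @dimH _ (@MetricSpace.toEMetricSpace _ sphMetric) s

/-- The coordinate `w = 1 / z` at infinity, read as a parametrisation of a neighbourhood of `∞`. -/
def invChart (w : ℂ) : OnePoint ℂ := if w = 0 then ∞ else ((w⁻¹ : ℂ) : OnePoint ℂ)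

/-- `F` is holomorphic on the open subset `U` of the Riemann sphere: it is so in the two standard
coordinates `z` and `w = 1 / z`. -/
def HolomorphicOn (U : Set (OnePoint ℂ)) (F : OnePoint ℂ → ℂ × ℂ) : Prop :=
  IsOpen U ∧
  DifferentiableOn ℂ (fun z : ℂ => F z) {z | (z : OnePoint ℂ) ∈ U} ∧
  DifferentiableOn ℂ (fun w : ℂ => F (invChart w)) {w | invChart w ∈ U}

/-- The differential of `F` vanishes nowhere on `U`. -/
def ImmersionOn (U : Set (OnePoint ℂ)) (F : OnePoint ℂ → ℂ × ℂ) : Prop :=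
  (∀ z : ℂ, (z : OnePoint ℂ) ∈ U → deriv (fun z : ℂ => F z) z ≠ 0) ∧
  (∀ w : ℂ, invChart w ∈ U → deriv (fun w : ℂ => F (invChart w)) w ≠ 0)

/-- The restriction of `F` to the open set `U` is a proper holomorphic embedding `U ↪ ℂ²`; the
values of `F` outside `U` play no role. -/
structure IsProperHolomorphicEmbeddingOn (U : Set (OnePoint ℂ)) (F : OnePoint ℂ → ℂ × ℂ) :
    Prop where
  holomorphicOn : HolomorphicOn U F
  immersionOn : ImmersionOn U F
  isEmbedding : IsEmbedding (U.domRestrict F)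
  isProperMap : IsProperMap (U.domRestrict F)

end RiemannSphere

/-- A Cantor set in a topological space: a subset homeomorphic to the ternary Cantor set. -/
def IsCantorSet {X : Type*} [TopologicalSpace X] (C : Set X) : Prop :=
  Nonempty (C ≃ₜ cantorSet)

namespace ShearConstruction

/-- The point at infinity of the one point compactification of `ℂ²`. -/
abbrev infty₂ : OnePoint (ℂ × ℂ) := ∞

/-- The `n`-th rational shear: `(x, y) ↦ (x, y + ε / (x - a))` for odd `n` and
`(x, y) ↦ (x + ε / (y - a), y)` for even `n`; the polar line is sent to the point at infinity, and
so is the point at infinity. -/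
def shear (n : ℕ) (a : ℂ) (ε : ℝ) : OnePoint (ℂ × ℂ) → OnePoint (ℂ × ℂ)
  | ∞ => ∞
  | ((x, y) : ℂ × ℂ) =>
      if Odd n then
        if x = a then ∞ else (((x, y + ε / (x - a)) : ℂ × ℂ) : OnePoint (ℂ × ℂ))
      else
        if y = a then ∞ else (((x + ε / (y - a), y) : ℂ × ℂ) : OnePoint (ℂ × ℂ))

/-- `γₙ(z) = fₙ ∘ ⋯ ∘ f₁ (z, 0)`, with `γₙ(∞) = ∞`. -/
def gammaSeq (a : ℕ → ℂ) (ε : ℕ → ℝ) : ℕ → OnePoint ℂ → OnePoint (ℂ × ℂ)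
  | 0 => OnePoint.map fun z : ℂ => (z, 0)
  | n + 1 => shear (n + 1) (a (n + 1)) (ε (n + 1)) ∘ gammaSeq a ε n

/-- The closed bidisc of radius `r`. -/
def bidisc (r : ℝ) : Set (ℂ × ℂ) := Metric.closedBall 0 r ×ˢ Metric.closedBall 0 r

/-- `Δₙ`, the preimage under `γₙ` of the complement of the bidisc `Bₙ` in the one point
compactification of `ℂ²`. -/
def Delta (a : ℕ → ℂ) (ε R : ℕ → ℝ) (n : ℕ) : Set (OnePoint ℂ) :=
  gammaSeq a ε n ⁻¹' (((↑) : ℂ × ℂ → OnePoint (ℂ × ℂ)) '' bidisc (R n))ᶜ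

/-- The finite part of a point of the compactification of `ℂ²` (with value `0` at infinity). -/
def finitePart (p : OnePoint (ℂ × ℂ)) : ℂ × ℂ := p.elim 0 id

/-- The poles of `γₙ`. -/
def poles (a : ℕ → ℂ) (ε : ℕ → ℝ) (n : ℕ) : Set (OnePoint ℂ) := gammaSeq a ε n ⁻¹' {infty₂}

/-- `bₙ = kₙ₊₁`, where `k₀ = k₁ = 1` and `kₙ₊₂ = kₙ₊₁ + kₙ`. -/
def b (n : ℕ) : ℕ := Nat.fib (n + 2)

/-- The constraints on the parameters `aₙ`, `εₙ` (`n ≥ 1`) and `Rₙ` (`n ≥ 0`); the values `a 0` and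
`ε 0` are not used. -/
structure IsParameterSystem (a : ℕ → ℂ) (ε R : ℕ → ℝ) : Prop where
  eps_pos : ∀ n, 1 ≤ n → 0 < ε n
  eps_lt : ∀ n, 1 ≤ n → ε (n + 1) < ε n
  eps_tendsto : Tendsto ε atTop (𝓝 0)
  R_pos : ∀ n, 0 < R n
  R_strictMono : StrictMono R
  R_tendsto : Tendsto R atTop atTop
  R_lt_norm : ∀ n, R n < ‖a (n + 1)‖
  norm_lt_R : ∀ n, ‖a (n + 1)‖ < R (n + 1)

end ShearConstruction

end

/-!
Up to exchanges of the two coordinates every shear of the construction is the map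
`henon a ε : (x, y) ↦ (y + ε / (x - a), x)`, so that `γₙ` becomes an iterate of such maps, with no
distinction of parities, and the two coordinates play alternating roles.

*Poles.* By induction, all the poles of `γₙ` are simple poles of exactly one coordinate, the other
one being regular (`HasPoleFst`, `HasPoleSnd`), and `γₙ` is an injective immersion elsewhere
(`IsStage`). Near a pole of the first coordinate `1 / x` is a local coordinate by the inverse
function theorem (`HasPoleFst.exists_isPoleNhd`); hence for a large radius `R` the part of a small
neighbourhood of the pole which is sent outside the bidisc is a topological disc, and it contains
exactly one point where `x = a`, for each `a` with `|a| > R`. Away from the poles `γₙ` is bounded by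
compactness, so for large `R` the components of `Δₙ` are these discs, one for each pole
(`IsStage.exists_isSeparation`). The next shear, with `|a| > R`, keeps the old poles and creates one
new pole next to each pole of the first coordinate (`IsStage.exists_succ`): the Fibonacci recursion.

*Parameters.* Only the radius `Rₙ` has to be chosen large in terms of `γₙ`; then `aₙ₊₁ = Rₙ + 1`,
`εₙ = 2⁻ⁿ⁻²` and `Rₙ₊₁ ≥ Rₙ + 2` will do. On the bidisc of radius `Rₙ` the next shear moves points by
at most `εₙ₊₁` and contracts distances at most by the factor `1 - εₙ₊₁`, and it keeps the exterior
of that bidisc outside the bidisc of radius `Rₙ - εₙ₊₁`. So `γₙ` converges off the intersection `C`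
of the sets `Δₙ`, and for points of the complement of `Δₘ` one has
`|γₘ(z) - γₘ(w)| ≤ 2 |γ(z) - γ(w)|` (`IsConstruction.dist_le_two_mul_dist_limitMap`), from which the
limit inherits injectivity and immersivity; on `Δₙ \ C` the limit is at least `Rₙ - 1` in norm
(`IsConstruction.norm_limitMap_ge`), which is properness.

*The Cantor set.* `C` is compact, its connected subsets are points as the components of `Δₙ` shrink,
and every pole has other poles nearby, so Brouwer's characterisation of the Cantor set
(`nonempty_homeomorph_nat_bool`) applies. Its dimension vanishes because `bₙ` sets of diameter less
than `bₙ⁻ⁿ` cover it.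
-/

/-! ### Topological characterisation of the Cantor set -/

section Cantor

variable {X : Type*} [TopologicalSpace X]

/-- In a space with a basis of clopen sets and no isolated point, a nonempty clopen set `A` splits
into two nonempty clopen pieces; if the clopen set `U` cuts `A`, it may be used as the divider. -/
lemma IsClopen.exists_split [CompactSpace X] [T2Space X] [TotallyDisconnectedSpace X]
    (hperf : ∀ x : X, (𝓝[≠] x).NeBot) {A U : Set X} (hA : IsClopen A) (hne : A.Nonempty)
    (hU : IsClopen U) :
    ∃ B ⊆ A, IsClopen B ∧ B.Nonempty ∧ (A \ B).Nonempty ∧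
      ((A ∩ U).Nonempty → (A \ U).Nonempty → B = A ∩ U) := by
  by_cases h : (A ∩ U).Nonempty ∧ (A \ U).Nonempty
  · exact ⟨A ∩ U, inter_subset_left, hA.inter hU, h.1, by simpa using h.2, fun _ _ => rfl⟩
  · obtain ⟨x, hx⟩ := hne
    obtain ⟨y, hyA, hyx⟩ : ∃ y ∈ A, y ≠ x := by
      have := hperf x
      have h1 : ∀ᶠ y in 𝓝[≠] x, y ∈ A ∧ y ≠ x :=
        (eventually_nhdsWithin_of_eventually_nhds (hA.isOpen.mem_nhds hx)).and
          self_mem_nhdsWithin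
      exact h1.exists.imp fun y hy => hy
    obtain ⟨V, hV, hxV, hyV⟩ := exists_isClopen_of_totally_separated hyx.symm
    exact ⟨A ∩ V, inter_subset_left, hA.inter hV, ⟨x, hx, hxV⟩, ⟨y, hyA, fun h => hyV h.2⟩,
      fun h1 h2 => (h ⟨h1, h2⟩).elim⟩

/-- Brouwer's theorem: a nonempty, compact, totally disconnected, second countable Hausdorff space
without isolated points is homeomorphic to `ℕ → Bool`. A sequence of clopen sets which separates
points is used to split the space again and again; a point is sent to its itinerary. -/
theorem nonempty_homeomorph_nat_bool [CompactSpace X] [T2Space X] [TotallyDisconnectedSpace X]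
    [SecondCountableTopology X] [Nonempty X] (hperf : ∀ x : X, (𝓝[≠] x).NeBot) :
    Nonempty (X ≃ₜ (ℕ → Bool)) := by
  classical
  have hc : Countable (TopologicalSpace.Clopens X) :=
    TopologicalSpace.Clopens.countable_iff_secondCountable.2 inferInstance
  obtain ⟨U, hU⟩ := exists_surjective_nat (TopologicalSpace.Clopens X)
  let S := {A : Set X // IsClopen A ∧ A.Nonempty}
  have hsplit : ∀ (A : S) (n : ℕ), ∃ B ⊆ A.1, IsClopen B ∧ B.Nonempty ∧ (A.1 \ B).Nonempty ∧
      ((A.1 ∩ U n).Nonempty → (A.1 \ U n).Nonempty → B = A.1 ∩ U n) := fun A n =>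
    A.2.1.exists_split hperf A.2.2 (U n).isClopen
  choose B hBA hBc hBn hBd hBU using hsplit
  let child : S → ℕ → Bool → S := fun A n t =>
    bif t then ⟨B A n, hBc A n, hBn A n⟩ else ⟨A.1 \ B A n, A.2.1.diff (hBc A n), hBd A n⟩
  have hchild : ∀ A n t x, x ∈ (child A n t).1 ↔ x ∈ A.1 ∧ decide (x ∈ B A n) = t := by
    intro A n t x
    cases t
    · simp [child]
    · simpa [child] using fun h => hBA A n h
  let top : S := ⟨univ, isClopen_univ, univ_nonempty⟩
  -- the piece containing `x` after `n` splittings, and the piece with a given itinerary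
  let piece : X → ℕ → S := fun x n => Nat.rec top (fun k A => child A k (decide (x ∈ B A k))) n
  let branch : (ℕ → Bool) → ℕ → S := fun s n => Nat.rec top (fun k A => child A k (s k)) n
  let f : X → ℕ → Bool := fun x n => decide (x ∈ B (piece x n) n)
  have hpb : ∀ x n, piece x n = branch (f x) n := by
    intro x n
    induction n with
    | zero => rfl
    | succ n ih =>
      change child (piece x n) n (f x n) = child (branch (f x) n) n (f x n)
      rw [ih]
  have hmem : ∀ x n, x ∈ (piece x n).1 := by
    intro x n
    induction n with
    | zero => exact mem_univ x
    | succ n ih => exact (hchild _ _ _ _).2 ⟨ih, rfl⟩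
  have hbranch : ∀ s x n, x ∈ (branch s n).1 → piece x n = branch s n := by
    intro s x n
    induction n with
    | zero => intro _; rfl
    | succ n ih =>
      intro hx
      obtain ⟨h1, h2⟩ := (hchild _ _ _ _).1 hx
      have h3 := ih h1
      change child (piece x n) n (decide (x ∈ B (piece x n) n)) = child (branch s n) n (s n)
      rw [h3, h2]
  have hbit : ∀ s x n, x ∈ (branch s (n + 1)).1 → f x n = s n := by
    intro s x n hx
    obtain ⟨h1, h2⟩ := (hchild _ _ _ _).1 hx
    rw [← h2]
    change decide (x ∈ B (piece x n) n) = _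
    rw [hbranch s x n h1]
  have hcont : Continuous f := by
    refine continuous_pi fun n => ?_
    rw [continuous_discrete_rng]
    intro t
    rw [isOpen_iff_mem_nhds]
    intro x hx
    have hopen : IsOpen (piece x (n + 1)).1 := (piece x (n + 1)).2.1.isOpen
    filter_upwards [hopen.mem_nhds (hmem x (n + 1))] with y hy
    have hy' : y ∈ (branch (f x) (n + 1)).1 := by rw [← hpb x (n + 1)]; exact hy
    exact (hbit _ _ _ hy').trans hx
  have hinj : Function.Injective f := by
    intro x y hxy
    by_contra hne
    obtain ⟨V, hV, hxV, hyV⟩ := exists_isClopen_of_totally_separated hne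
    obtain ⟨n, hn⟩ := hU ⟨V, hV⟩
    have hVn : (U n : Set X) = V := by rw [hn]; rfl
    have hp : piece x n = piece y n := by rw [hpb, hpb, hxy]
    have hB := hBU (piece x n) n ⟨x, hmem x n, by rwa [hVn]⟩
      ⟨y, by rw [hp]; exact hmem y n, by rw [hVn]; exact hyV⟩
    have h1 : x ∈ B (piece x n) n := by rw [hB, hVn]; exact ⟨hmem x n, hxV⟩
    have h2 : y ∉ B (piece y n) n := by rw [← hp, hB, hVn]; exact fun h => hyV h.2
    have h3 := congrFun hxy n
    simp only [f, h1, h2, decide_true, decide_false] at h3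
    exact Bool.noConfusion h3
  have hsurj : Function.Surjective f := by
    intro s
    have hanti : ∀ n, (branch s (n + 1)).1 ⊆ (branch s n).1 := fun n x hx =>
      ((hchild _ _ _ _).1 hx).1
    obtain ⟨x, hx⟩ := IsCompact.nonempty_iInter_of_sequence_nonempty_isCompact_isClosed
      (fun n => (branch s n).1) hanti (fun n => (branch s n).2.2)
      (branch s 0).2.1.isClosed.isCompact (fun n => (branch s n).2.1.isClosed)
    exact ⟨x, funext fun n => hbit s x n (mem_iInter.1 hx (n + 1))⟩
  exact ⟨hcont.homeoOfEquivCompactToT2 (f := Equiv.ofBijective f ⟨hinj, hsurj⟩)⟩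

end Cantor

/-! ### Hausdorff dimension zero from efficient covers -/

open scoped ENNReal NNReal in
/-- A set covered, for every large `n`, by `bₙ` sets of diameter at most `bₙ⁻ⁿ`, where `bₙ → ∞`,
has Hausdorff dimension zero. -/
lemma dimH_eq_zero_of_cover {X ι : Type*} [EMetricSpace X] {C : Set X} {P : ℕ → Finset ι}
    {t : ℕ → ι → Set X} (hP : Tendsto (fun n => (P n).card) atTop atTop)
    (hcov : ∀ᶠ n in atTop, C ⊆ ⋃ p ∈ P n, t n p)
    (hdiam : ∀ᶠ n in atTop, ∀ p ∈ P n, Metric.ediam (t n p) ≤ (((P n).card : ℝ≥0∞)⁻¹) ^ n) :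
    dimH C = 0 := by
  let : MeasurableSpace X := borel X
  have : BorelSpace X := ⟨rfl⟩
  have hinv : Tendsto (fun n => ((P n).card : ℝ≥0∞)⁻¹) atTop (𝓝 0) := by
    have := ENNReal.tendsto_inv_nat_nhds_zero.comp hP
    exact this
  have hle1 : ∀ᶠ n in atTop, ((P n).card : ℝ≥0∞)⁻¹ ≤ 1 :=
    (hP.eventually_ge_atTop 1).mono fun n hn => ENNReal.inv_le_one.2 (by exact_mod_cast hn)
  have key : ∀ d : ℝ≥0, 0 < d → MeasureTheory.Measure.hausdorffMeasure (d : ℝ) C = 0 := by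
    intro d hd
    have hd' : (0 : ℝ) < d := hd
    have hr : ∀ᶠ n : ℕ in atTop, (((P n).card : ℝ≥0∞)⁻¹) ^ n ≤ ((P n).card : ℝ≥0∞)⁻¹ := by
      filter_upwards [hle1, eventually_ge_atTop 1] with n hn h1
      simpa using pow_le_pow_right_of_le_one' hn h1
    have h1 := MeasureTheory.Measure.hausdorffMeasure_le_liminf_sum (ι := fun n => P n) (d : ℝ) C
      (l := atTop) _ hinv (fun n p => t n p)
      (by filter_upwards [hdiam, hr] with n hn hr p using (hn p p.2).trans hr)
      (by
        filter_upwards [hcov] with n hn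
        refine hn.trans (iUnion₂_subset fun p hp => ?_)
        exact subset_iUnion_of_subset ⟨p, hp⟩ subset_rfl)
    refine le_antisymm (h1.trans ?_) zero_le
    have h2 : ∀ᶠ n : ℕ in atTop, ∑ p : P n, Metric.ediam (t n p) ^ (d : ℝ)
        ≤ ((P n).card : ℝ≥0∞)⁻¹ := by
      have hnd : ∀ᶠ n : ℕ in atTop, (2 : ℝ) ≤ n * d :=
        (tendsto_natCast_atTop_atTop.atTop_mul_const hd').eventually_ge_atTop 2
      filter_upwards [hdiam, hle1, hnd, hP.eventually_ge_atTop 1] with n hn h1 hnd hc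
      set q : ℝ≥0∞ := ((P n).card : ℝ≥0∞) with hq
      have hq0 : q ≠ 0 := by rw [hq]; exact_mod_cast (Nat.one_le_iff_ne_zero.1 hc)
      have hqt : q ≠ ⊤ := ENNReal.natCast_ne_top _
      have h3 : ∀ p : P n, Metric.ediam (t n p) ^ (d : ℝ) ≤ q⁻¹ * q⁻¹ := by
        intro p
        calc Metric.ediam (t n p) ^ (d : ℝ) ≤ (q⁻¹ ^ n) ^ (d : ℝ) :=
              ENNReal.rpow_le_rpow (hn p p.2) hd'.le
          _ = q⁻¹ ^ ((n : ℝ) * d) := by rw [ENNReal.rpow_mul, ENNReal.rpow_natCast]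
          _ ≤ q⁻¹ ^ (2 : ℝ) := ENNReal.rpow_le_rpow_of_exponent_ge h1 hnd
          _ = q⁻¹ * q⁻¹ := by rw [ENNReal.rpow_two, sq]
      calc ∑ p : P n, Metric.ediam (t n p) ^ (d : ℝ) ≤ ∑ _p : P n, q⁻¹ * q⁻¹ :=
            Finset.sum_le_sum fun p _ => h3 p
        _ = q * (q⁻¹ * q⁻¹) := by simp [hq]
        _ = q⁻¹ := by rw [← mul_assoc, ENNReal.mul_inv_cancel hq0 hqt, one_mul]
    calc _ ≤ liminf (fun n => ((P n).card : ℝ≥0∞)⁻¹) atTop := liminf_le_liminf h2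
      _ = 0 := hinv.liminf_eq
  rw [← nonpos_iff_eq_zero, dimH_eq_iInf]
  refine ENNReal.le_of_forall_pos_le_add fun d hd _ => ?_
  rw [zero_add]
  exact iInf₂_le_of_le d (key d hd) le_rfl

/-! ### The chart at infinity -/

namespace RiemannSphere

lemma invChart_zero : invChart 0 = ∞ := if_pos rfl

lemma invChart_of_ne {w : ℂ} (hw : w ≠ 0) : invChart w = ((w⁻¹ : ℂ) : OnePoint ℂ) := if_neg hw

lemma tendsto_cocompact_coe_infty :
    Tendsto ((↑) : ℂ → OnePoint ℂ) (cocompact ℂ) (𝓝 ∞) := by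
  rw [← coclosedCompact_eq_cocompact]; exact tendsto_coe_infty

lemma continuous_invChart : Continuous invChart := by
  rw [continuous_iff_continuousAt]
  intro w
  rcases eq_or_ne w 0 with rfl | hw
  · rw [continuousAt_iff_punctured_nhds, invChart_zero]
    have h1 : Tendsto (fun w : ℂ => w⁻¹) (𝓝[≠] 0) (cocompact ℂ) := by
      rw [← Metric.cobounded_eq_cocompact]; exact tendsto_inv₀_nhdsNE_zero
    refine (tendsto_cocompact_coe_infty.comp h1).congr' ?_
    filter_upwards [self_mem_nhdsWithin] with w hw
    exact (invChart_of_ne hw).symm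
  · have h : ContinuousAt (fun w : ℂ => ((w⁻¹ : ℂ) : OnePoint ℂ)) w :=
      (continuous_coe.continuousAt).comp (continuousAt_inv₀ hw)
    refine h.congr ?_
    filter_upwards [isOpen_ne.mem_nhds hw] with v hv
    exact (invChart_of_ne hv).symm

/-- The inversion `z ↦ 1 / z` of the Riemann sphere. -/
noncomputable def inversion : OnePoint ℂ → OnePoint ℂ
  | ∞ => ((0 : ℂ) : OnePoint ℂ)
  | (z : ℂ) => invChart z

lemma inversion_involutive : Function.Involutive inversion := by
  intro x
  induction x using OnePoint.rec with
  | infty => exact invChart_zero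
  | coe z =>
    change inversion (invChart z) = z
    rcases eq_or_ne z 0 with rfl | hz
    · rw [invChart_zero]; rfl
    · rw [invChart_of_ne hz]
      change invChart z⁻¹ = z
      rw [invChart_of_ne (inv_ne_zero hz), inv_inv]

lemma continuous_inversion : Continuous inversion := by
  rw [OnePoint.continuous_iff]
  refine ⟨?_, continuous_invChart⟩
  have h : Tendsto (fun z : ℂ => ((z⁻¹ : ℂ) : OnePoint ℂ)) (cocompact ℂ) (𝓝 ((0 : ℂ))) := by
    refine (continuous_coe.tendsto _).comp ?_
    rw [← Metric.cobounded_eq_cocompact]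
    exact tendsto_inv₀_cobounded
  rw [coclosedCompact_eq_cocompact]
  refine h.congr' ?_
  have : ∀ᶠ z : ℂ in cocompact ℂ, z ≠ 0 := by
    filter_upwards [(isCompact_singleton (x := (0 : ℂ))).compl_mem_cocompact] with z hz
    exact hz
  filter_upwards [this] with z hz
  exact (invChart_of_ne hz).symm

lemma isOpenEmbedding_invChart : IsOpenEmbedding invChart :=
  (Homeomorph.mk (inversion_involutive.toPerm) continuous_inversion
    continuous_inversion).isOpenEmbedding.comp isOpenEmbedding_coe

end RiemannSphere

open RiemannSphere

namespace ShearConstruction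

/-! ### Simple poles of maps into the compactified plane -/

/-- The map `(x, y) ↦ (y + ε / (x - a), x)`: a rational shear followed by the exchange of the two
coordinates. Up to exchanges of the coordinates all the shears of the construction have this
form, whatever the parity. -/
noncomputable def henon (a : ℂ) (ε : ℝ) : OnePoint (ℂ × ℂ) → OnePoint (ℂ × ℂ)
  | ∞ => ∞
  | ((x, y) : ℂ × ℂ) => if x = a then ∞ else (((y + ε / (x - a), x) : ℂ × ℂ) : OnePoint (ℂ × ℂ))

lemma henon_infty (a : ℂ) (ε : ℝ) : henon a ε ∞ = ∞ := rfl

lemma henon_coe (a : ℂ) (ε : ℝ) (x y : ℂ) : henon a ε ((x, y) : ℂ × ℂ) =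
    if x = a then ∞ else (((y + ε / (x - a), x) : ℂ × ℂ) : OnePoint (ℂ × ℂ)) := rfl

lemma henon_of_ne {a x : ℂ} (h : x ≠ a) (ε : ℝ) (y : ℂ) : henon a ε ((x, y) : ℂ × ℂ) =
    (((y + ε / (x - a), x) : ℂ × ℂ) : OnePoint (ℂ × ℂ)) := if_neg h

lemma henon_self (a : ℂ) (ε : ℝ) (y : ℂ) : henon a ε ((a, y) : ℂ × ℂ) = ∞ := if_pos rfl

/-- The exchange of the two coordinates. -/
def swapInfty : OnePoint (ℂ × ℂ) → OnePoint (ℂ × ℂ) := OnePoint.map Prod.swap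

lemma swapInfty_coe (x y : ℂ) :
    swapInfty ((x, y) : ℂ × ℂ) = (((y, x) : ℂ × ℂ) : OnePoint (ℂ × ℂ)) := rfl

lemma swapInfty_infty : swapInfty ∞ = ∞ := rfl

lemma swapInfty_involutive : Function.Involutive swapInfty := by
  intro p
  induction p using OnePoint.rec <;> rfl

lemma swapInfty_eq_infty {p : OnePoint (ℂ × ℂ)} : swapInfty p = ∞ ↔ p = ∞ := by
  rw [← swapInfty_involutive.injective.eq_iff (a := p), swapInfty_infty]

lemma swapInfty_eq_coe {p : OnePoint (ℂ × ℂ)} {x y : ℂ} :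
    swapInfty p = ((x, y) : ℂ × ℂ) ↔ p = ((y, x) : ℂ × ℂ) := by
  rw [← swapInfty_involutive.injective.eq_iff (a := p), swapInfty_coe]

/-- `F` has at `p` a simple pole of its first coordinate, the second one being regular: in a chart
`φ` centred at `p` one has `F = (1 / u, v)`, where `u` and `v` are analytic and `u` has a simple
zero. The chart is allowed to be any open embedding of `ℂ`, so that `∞` needs no special care. -/
def HasPoleFst (F : OnePoint ℂ → OnePoint (ℂ × ℂ)) (p : OnePoint ℂ) : Prop :=
  F p = ∞ ∧ ∃ (φ : ℂ → OnePoint ℂ) (u v : ℂ → ℂ), IsOpenEmbedding φ ∧ φ 0 = p ∧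
    AnalyticAt ℂ u 0 ∧ AnalyticAt ℂ v 0 ∧ u 0 = 0 ∧ deriv u 0 ≠ 0 ∧
    ∀ᶠ t in 𝓝[≠] 0, F (φ t) = (((u t)⁻¹, v t) : ℂ × ℂ)

/-- `F` has at `p` a simple pole of its second coordinate, the first one being regular. -/
def HasPoleSnd (F : OnePoint ℂ → OnePoint (ℂ × ℂ)) (p : OnePoint ℂ) : Prop :=
  HasPoleFst (swapInfty ∘ F) p

lemma hasPoleFst_of_chart {F : OnePoint ℂ → OnePoint (ℂ × ℂ)} {φ : ℂ → OnePoint ℂ} {u v : ℂ → ℂ}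
    {t₀ : ℂ} (hφ : IsOpenEmbedding φ) (hF : F (φ t₀) = ∞) (hu : AnalyticAt ℂ u t₀)
    (hv : AnalyticAt ℂ v t₀) (h0 : u t₀ = 0) (h1 : deriv u t₀ ≠ 0)
    (h : ∀ᶠ t in 𝓝[≠] t₀, F (φ t) = (((u t)⁻¹, v t) : ℂ × ℂ)) : HasPoleFst F (φ t₀) := by
  refine ⟨hF, fun t => φ (t₀ + t), fun t => u (t₀ + t), fun t => v (t₀ + t),
    hφ.comp (Homeomorph.addLeft t₀).isOpenEmbedding, by simp, ?_, ?_, by simpa using h0, ?_, ?_⟩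
  · exact AnalyticAt.fun_comp (by simpa using hu) (by fun_prop)
  · exact AnalyticAt.fun_comp (by simpa using hv) (by fun_prop)
  · simpa [deriv_comp_const_add] using h1
  · have ht : Tendsto (fun t => t₀ + t) (𝓝[≠] 0) (𝓝[≠] t₀) := by
      have hc : Tendsto (fun t => t₀ + t) (𝓝 0) (𝓝 t₀) := by
        have : Continuous fun t => t₀ + t := by fun_prop
        simpa using this.tendsto 0
      refine tendsto_nhdsWithin_iff.2 ⟨hc.mono_left nhdsWithin_le_nhds, ?_⟩
      filter_upwards [self_mem_nhdsWithin] with t ht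
      simpa using ht
    exact ht.eventually h

lemma analyticAt_div_simple_zero {f g : ℂ → ℂ} {t : ℂ} (hf : AnalyticAt ℂ f t)
    (hg : AnalyticAt ℂ g t) (h0 : f t = 0) (h1 : deriv f t ≠ 0) (hg0 : g t ≠ 0) :
    AnalyticAt ℂ (fun s => f s / g s) t ∧ deriv (fun s => f s / g s) t ≠ 0 := by
  refine ⟨hf.fun_div hg hg0, ?_⟩
  rw [deriv_fun_div hf.differentiableAt hg.differentiableAt hg0, h0]
  simp [h1, hg0]

lemma eventually_ne_of_deriv_ne_zero {u : ℂ → ℂ} {t : ℂ} (hu : AnalyticAt ℂ u t)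
    (h1 : deriv u t ≠ 0) (c : ℂ) : ∀ᶠ s in 𝓝[≠] t, u s ≠ c :=
  hu.differentiableAt.hasDerivAt.eventually_ne h1

lemma eventually_nhdsNE_ne {u : ℂ → ℂ} {t : ℂ} (hu : AnalyticAt ℂ u t)
    {c : ℂ} (h1 : u t ≠ c) : ∀ᶠ s in 𝓝[≠] t, u s ≠ c :=
  (hu.continuousAt.eventually_ne h1).filter_mono nhdsWithin_le_nhds

/-- A pole of the first coordinate becomes one of the second coordinate. -/
lemma HasPoleFst.henon {F : OnePoint ℂ → OnePoint (ℂ × ℂ)} {p : OnePoint ℂ} (h : HasPoleFst F p)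
    (a : ℂ) (ε : ℝ) : HasPoleSnd (henon a ε ∘ F) p := by
  obtain ⟨hp, φ, u, v, hφ, rfl, hu, hv, h0, h1, hF⟩ := h
  have h2 : (1 : ℂ) - a * u 0 ≠ 0 := by simp [h0]
  have hd : AnalyticAt ℂ (fun t => 1 - a * u t) 0 := by fun_prop
  refine ⟨by simp [hp, henon_infty, swapInfty_infty], φ, u,
    fun t => v t + ε * u t / (1 - a * u t), hφ, rfl, hu, ?_, h0, h1, ?_⟩
  · exact hv.fun_add ((analyticAt_const.fun_mul hu).fun_div hd h2)
  · filter_upwards [hF, eventually_ne_of_deriv_ne_zero hu h1 0,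
      eventually_nhdsNE_ne hd h2] with t ht hut hdt
    have hne : (u t)⁻¹ ≠ a := by
      rintro rfl
      exact hdt (by simp [hut])
    have hne' := sub_ne_zero.2 hne
    rw [Function.comp_apply, Function.comp_apply, ht, henon_of_ne hne, swapInfty_coe]
    congr 2
    have : (u t)⁻¹ - a = (1 - a * u t) / u t := by field_simp
    rw [this, div_div_eq_mul_div]

/-- A pole of the second coordinate becomes one of the first coordinate, provided that the value
of the first coordinate at the pole is not `a`; the bound by `R < ‖a‖` ensures this. -/
lemma HasPoleSnd.henon {F : OnePoint ℂ → OnePoint (ℂ × ℂ)} {p : OnePoint ℂ} (h : HasPoleSnd F p)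
    {a : ℂ} (ε : ℝ) {R : ℝ} (hR : ∀ᶠ z in 𝓝 p, ∀ x y : ℂ, F z = ((x, y) : ℂ × ℂ) → ‖x‖ ≤ R)
    (ha : R < ‖a‖) : HasPoleFst (henon a ε ∘ F) p := by
  obtain ⟨hp, φ, u, v, hφ, rfl, hu, hv, h0, h1, hF⟩ := h
  have hF' : ∀ᶠ t in 𝓝[≠] 0, F (φ t) = ((v t, (u t)⁻¹) : ℂ × ℂ) := by
    filter_upwards [hF] with t ht using swapInfty_eq_coe.1 ht
  have hva : v 0 ≠ a := by
    have hle : ‖v 0‖ ≤ R := by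
      have ht : Tendsto (fun t => ‖v t‖) (𝓝[≠] 0) (𝓝 ‖v 0‖) :=
        (hv.continuousAt.norm.tendsto).mono_left nhdsWithin_le_nhds
      refine le_of_tendsto ht ?_
      filter_upwards [hF', (hφ.continuous.continuousAt.eventually hR).filter_mono
        nhdsWithin_le_nhds] with t h1 h2 using h2 _ _ h1
    rintro rfl
    exact absurd ha hle.not_gt
  have hd : AnalyticAt ℂ (fun t => 1 + ε * u t / (v t - a)) 0 := by
    refine analyticAt_const.fun_add ((analyticAt_const.fun_mul hu).fun_div
      (hv.fun_sub analyticAt_const) (sub_ne_zero.2 hva))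
  have hd0 : (fun t => 1 + ε * u t / (v t - a)) 0 ≠ 0 := by simp [h0]
  obtain ⟨h3, h4⟩ := analyticAt_div_simple_zero hu hd h0 h1 hd0
  refine ⟨by simp [swapInfty_eq_infty.1 hp, henon_infty], φ, _, v, hφ, rfl, h3, hv,
    by simp [h0], h4, ?_⟩
  filter_upwards [hF', eventually_ne_of_deriv_ne_zero hu h1 0,
      eventually_nhdsNE_ne hv hva] with t ht hut hvt
  rw [Function.comp_apply, ht, henon_of_ne hvt]
  congr 2
  have hva' := sub_ne_zero.2 hvt
  rw [inv_div]
  field_simp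

/-! ### Local description of a map near a simple pole -/

/-- The points sent outside the closed bidisc of radius `R`, poles included. -/
def exterior (F : OnePoint ℂ → OnePoint (ℂ × ℂ)) (R : ℝ) : Set (OnePoint ℂ) :=
  F ⁻¹' (((↑) : ℂ × ℂ → OnePoint (ℂ × ℂ)) '' bidisc R)ᶜ

lemma coe_mem_bidisc {x y : ℂ} {R : ℝ} : (x, y) ∈ bidisc R ↔ ‖x‖ ≤ R ∧ ‖y‖ ≤ R := by
  simp [bidisc]

lemma mem_exterior {F : OnePoint ℂ → OnePoint (ℂ × ℂ)} {R : ℝ} {z : OnePoint ℂ} :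
    z ∈ exterior F R ↔ ∀ x y : ℂ, F z = ((x, y) : ℂ × ℂ) → R < ‖x‖ ∨ R < ‖y‖ := by
  simp only [exterior, mem_preimage, mem_compl_iff, mem_image, Prod.exists, not_exists, not_and]
  refine forall₂_congr fun x y => ?_
  rw [coe_mem_bidisc, ← not_le, ← not_le, ← not_and_or]
  constructor
  · exact fun h h1 h2 => h h2 h1.symm
  · exact fun h h1 h2 => h h2.symm h1

lemma notMem_exterior {F : OnePoint ℂ → OnePoint (ℂ × ℂ)} {R : ℝ} {z : OnePoint ℂ} :
    z ∉ exterior F R ↔ ∃ x y : ℂ, F z = ((x, y) : ℂ × ℂ) ∧ ‖x‖ ≤ R ∧ ‖y‖ ≤ R := by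
  rw [mem_exterior]; push Not; rfl

lemma mem_exterior_of_eq_infty {F : OnePoint ℂ → OnePoint (ℂ × ℂ)} {R : ℝ} {z : OnePoint ℂ}
    (h : F z = ∞) : z ∈ exterior F R := by
  rw [mem_exterior]; intro x y hxy
  rw [h] at hxy; exact (OnePoint.infty_ne_coe _ hxy).elim

lemma exterior_swap (F : OnePoint ℂ → OnePoint (ℂ × ℂ)) (R : ℝ) :
    exterior (swapInfty ∘ F) R = exterior F R := by
  ext z
  simp only [mem_exterior, Function.comp_apply, swapInfty_eq_coe]
  exact ⟨fun h x y hxy => (h y x hxy).symm, fun h x y hxy => (h y x hxy).symm⟩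

/-- A neighbourhood `N` of a pole `p` of the first coordinate of `F` in which `1 / x` is a local
coordinate, and in which the second coordinate is bounded by `R`. -/
structure IsPoleNhd (F : OnePoint ℂ → OnePoint (ℂ × ℂ)) (p : OnePoint ℂ) (N : Set (OnePoint ℂ))
    (R : ℝ) : Prop where
  isOpen : IsOpen N
  mem : p ∈ N
  eq_of_infty : ∀ z ∈ N, F z = ∞ → z = p
  snd_le : ∀ z ∈ N, ∀ x y : ℂ, F z = ((x, y) : ℂ × ℂ) → ‖y‖ ≤ R
  isPreconnected : IsPreconnected (N ∩ exterior F R)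
  exists_fst : ∀ a : ℂ, R < ‖a‖ → ∃ z ∈ N, ∃ y : ℂ, F z = ((a, y) : ℂ × ℂ)
  fst_inj : ∀ a y y' : ℂ, ∀ z ∈ N, ∀ w ∈ N, F z = ((a, y) : ℂ × ℂ) → F w = ((a, y') : ℂ × ℂ) → z = w
  new_pole : ∀ a y : ℂ, R < ‖a‖ → ∀ z ∈ N, F z = ((a, y) : ℂ × ℂ) → ∀ ε : ℝ, ε ≠ 0 →
    HasPoleFst (henon a ε ∘ F) z

/-- A local inverse `ψ` of a function with a simple zero at the origin, defined on a disc and with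
values in a given neighbourhood of the origin. -/
lemma exists_local_section {u : ℂ → ℂ} (hu : AnalyticAt ℂ u 0) (h0 : u 0 = 0) (h1 : deriv u 0 ≠ 0)
    {S : Set ℂ} (hS : IsOpen S) (h0S : (0 : ℂ) ∈ S) :
    ∃ s > 0, ∃ ψ : ℂ → ℂ, ContinuousOn ψ (Metric.ball 0 s) ∧ ψ 0 = 0 ∧
      (∀ τ ∈ Metric.ball 0 s, ψ τ ∈ S ∧ u (ψ τ) = τ) ∧ IsOpen (ψ '' Metric.ball 0 s) := by
  have hd := (hu.hasStrictDerivAt.hasStrictFDerivAt_equiv h1)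
  set E := hd.toOpenPartialHomeomorph u with hE
  have hEu : ∀ t, E t = u t := fun t => rfl
  have h0s : (0 : ℂ) ∈ E.source := hd.mem_toOpenPartialHomeomorph_source
  have h0t : (0 : ℂ) ∈ E.target := by
    have := E.map_source h0s
    rwa [hEu, h0] at this
  have hsymm0 : E.symm 0 = 0 := by
    have := E.left_inv h0s
    rwa [hEu, h0] at this
  have hn : E.target ∩ E.symm ⁻¹' S ∈ 𝓝 (0 : ℂ) :=
    inter_mem (E.open_target.mem_nhds h0t)
      ((E.continuousAt_symm h0t).preimage_mem_nhds (by rw [hsymm0]; exact hS.mem_nhds h0S))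
  obtain ⟨s, hs, hsub⟩ := Metric.mem_nhds_iff.1 hn
  refine ⟨s, hs, E.symm, E.continuousOn_symm.mono fun τ hτ => (hsub hτ).1, hsymm0,
    fun τ hτ => ⟨(hsub hτ).2, E.right_inv (hsub hτ).1⟩, ?_⟩
  exact E.symm.isOpen_image_of_subset_source Metric.isOpen_ball fun τ hτ => (hsub hτ).1

/-- A pole of the first coordinate has arbitrarily small neighbourhoods `N` in which `τ = 1 / x` is
a coordinate. For large `R` the part of `N` sent outside the bidisc is the disc `|τ| < 1 / R`. -/
theorem HasPoleFst.exists_isPoleNhd {F : OnePoint ℂ → OnePoint (ℂ × ℂ)} {p : OnePoint ℂ}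
    (h : HasPoleFst F p) {U : Set (OnePoint ℂ)} (hU : U ∈ 𝓝 p) :
    ∃ N ⊆ U, ∃ R₀ : ℝ, ∀ R ≥ R₀, IsPoleNhd F p N R := by
  obtain ⟨hp, φ, u, v, hφ, rfl, hu, hv, h0, h1, hF⟩ := h
  have hS : ∀ᶠ t in 𝓝 (0 : ℂ), AnalyticAt ℂ u t ∧ AnalyticAt ℂ v t ∧ deriv u t ≠ 0 ∧
      ‖v t‖ < ‖v 0‖ + 1 ∧ (t ≠ 0 → F (φ t) = (((u t)⁻¹, v t) : ℂ × ℂ)) ∧ φ t ∈ U := by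
    filter_upwards [hu.eventually_analyticAt, hv.eventually_analyticAt,
      hu.deriv.continuousAt.eventually_ne h1,
      hv.continuousAt.norm.eventually_lt continuousAt_const (lt_add_one ‖v 0‖),
      eventually_nhdsWithin_iff.1 hF, hφ.continuous.continuousAt.preimage_mem_nhds hU]
      with t h1 h2 h3 h4 h5 h6 using ⟨h1, h2, h3, h4, h5, h6⟩
  obtain ⟨S, hSP, hSo, h0S⟩ := mem_nhds_iff.1 hS
  obtain ⟨s, hs, ψ, hψc, hψ0, hψ, hψo⟩ := exists_local_section hu h0 h1 hSo h0S
  have hne : ∀ τ ∈ Metric.ball (0 : ℂ) s, τ ≠ 0 → ψ τ ≠ 0 := by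
    intro τ hτ h h'
    have := (hψ τ hτ).2
    rw [h', h0] at this
    exact h this.symm
  have hval : ∀ τ ∈ Metric.ball (0 : ℂ) s, τ ≠ 0 →
      F (φ (ψ τ)) = ((τ⁻¹, v (ψ τ)) : ℂ × ℂ) := by
    intro τ hτ h
    have := (hSP (hψ τ hτ).1).2.2.2.2.1 (hne τ hτ h)
    rwa [(hψ τ hτ).2] at this
  have hfin : ∀ τ ∈ Metric.ball (0 : ℂ) s, ∀ x y : ℂ, F (φ (ψ τ)) = ((x, y) : ℂ × ℂ) →
      τ ≠ 0 ∧ τ = x⁻¹ ∧ x ≠ 0 ∧ y = v (ψ τ) := by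
    intro τ hτ x y hxy
    have hτ0 : τ ≠ 0 := by
      rintro rfl
      rw [hψ0, hp] at hxy
      exact OnePoint.infty_ne_coe _ hxy
    rw [hval τ hτ hτ0, OnePoint.coe_eq_coe, Prod.mk.injEq] at hxy
    refine ⟨hτ0, by rw [← hxy.1, inv_inv], ?_, hxy.2.symm⟩
    rw [← hxy.1]; exact inv_ne_zero hτ0
  refine ⟨φ '' (ψ '' Metric.ball 0 s), ?_, max s⁻¹ (‖v 0‖ + 1) + 1, fun R hR => ?_⟩
  · rintro _ ⟨_, ⟨τ, hτ, rfl⟩, rfl⟩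
    exact (hSP (hψ τ hτ).1).2.2.2.2.2
  have hRs : s⁻¹ < R := by linarith [le_max_left s⁻¹ (‖v 0‖ + 1)]
  have hRv : ‖v 0‖ + 1 ≤ R := by linarith [le_max_right s⁻¹ (‖v 0‖ + 1)]
  have hR0 : 0 < R := (inv_pos.2 hs).trans hRs
  have hinv : ∀ a : ℂ, R < ‖a‖ → a⁻¹ ∈ Metric.ball (0 : ℂ) s := by
    intro a ha
    rw [mem_ball_zero_iff, norm_inv]
    exact inv_lt_of_inv_lt₀ hs (hRs.trans ha)
  constructor
  · exact hφ.isOpenMap _ hψo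
  · exact ⟨0, ⟨0, Metric.mem_ball_self hs, hψ0⟩, rfl⟩
  · rintro _ ⟨_, ⟨τ, hτ, rfl⟩, rfl⟩ hz
    by_contra hne'
    have hτ0 : τ ≠ 0 := by rintro rfl; exact hne' (by rw [hψ0])
    rw [hval τ hτ hτ0] at hz
    exact OnePoint.coe_ne_infty _ hz
  · rintro _ ⟨_, ⟨τ, hτ, rfl⟩, rfl⟩ x y hxy
    rw [(hfin τ hτ x y hxy).2.2.2]
    exact ((hSP (hψ τ hτ).1).2.2.2.1.le).trans hRv
  · -- for `τ ≠ 0` the second coordinate is bounded by `R`, so only `|x| = 1 / |τ|` matters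
    have himg : φ '' (ψ '' Metric.ball 0 s) ∩ exterior F R
        = (φ ∘ ψ) '' Metric.ball (0 : ℂ) R⁻¹ := by
      ext z
      constructor
      · rintro ⟨⟨_, ⟨τ, hτ, rfl⟩, rfl⟩, hz⟩
        refine ⟨τ, ?_, rfl⟩
        rcases eq_or_ne τ 0 with rfl | hτ0
        · exact Metric.mem_ball_self (inv_pos.2 hR0)
        · rw [mem_ball_zero_iff]
          rcases mem_exterior.1 hz _ _ (hval τ hτ hτ0) with h | h
          · rw [norm_inv] at h
            exact lt_inv_of_lt_inv₀ hR0 h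
          · exact absurd (h.trans ((hSP (hψ τ hτ).1).2.2.2.1)) hRv.not_gt
      · rintro ⟨τ, hτ, rfl⟩
        have hτs : τ ∈ Metric.ball (0 : ℂ) s :=
          Metric.ball_subset_ball (inv_lt_of_inv_lt₀ hs hRs).le hτ
        refine ⟨⟨_, ⟨τ, hτs, rfl⟩, rfl⟩, mem_exterior.2 fun x y hxy => Or.inl ?_⟩
        obtain ⟨h1, rfl, h3, -⟩ := hfin τ hτs x y hxy
        rw [mem_ball_zero_iff, norm_inv] at hτ
        exact (inv_lt_inv₀ (norm_pos_iff.2 h3) hR0).1 hτ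
    rw [himg]
    refine (convex_ball _ _).isPreconnected.image _ (hφ.continuous.comp_continuousOn (hψc.mono ?_))
    exact Metric.ball_subset_ball (inv_lt_of_inv_lt₀ hs hRs).le
  · intro a ha
    have ha0 : a ≠ 0 := by rintro rfl; simp at ha; linarith
    exact ⟨_, ⟨_, ⟨a⁻¹, hinv a ha, rfl⟩, rfl⟩, v (ψ a⁻¹),
      by rw [hval _ (hinv a ha) (inv_ne_zero ha0), inv_inv]⟩
  · rintro a y y' _ ⟨_, ⟨τ, hτ, rfl⟩, rfl⟩ _ ⟨_, ⟨σ, hσ, rfl⟩, rfl⟩ hz hw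
    rw [(hfin τ hτ _ _ hz).2.1, (hfin σ hσ _ _ hw).2.1]
  · rintro a y ha _ ⟨_, ⟨τ, hτ, rfl⟩, rfl⟩ hz ε hε
    obtain ⟨hτ0, hτa, ha0, rfl⟩ := hfin τ hτ _ _ hz
    have hε' : (ε : ℂ) ≠ 0 := Complex.ofReal_ne_zero.2 hε
    obtain ⟨hau, hav, hdu, -⟩ := hSP (hψ τ hτ).1
    have huτ : u (ψ τ) = a⁻¹ := (hψ τ hτ).2.trans hτa
    -- at the new pole `1 / (y + ε / (x - a))` is the quotient of `1 - a u` and `v (1 - a u) + ε u`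
    have hnum : AnalyticAt ℂ (fun t => 1 - a * u t) (ψ τ) := by fun_prop
    have hden : AnalyticAt ℂ (fun t => v t * (1 - a * u t) + ε * u t) (ψ τ) := by fun_prop
    have hnum0 : (fun t => 1 - a * u t) (ψ τ) = 0 := by simp [huτ, ha0]
    have hden0 : (fun t => v t * (1 - a * u t) + ε * u t) (ψ τ) ≠ 0 := by
      simp [huτ, ha0, hε']
    have hnum1 : deriv (fun t => 1 - a * u t) (ψ τ) ≠ 0 := by
      rw [deriv_const_sub, deriv_const_mul _ hau.differentiableAt]
      simp [ha0, hdu]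
    obtain ⟨h3, h4⟩ := analyticAt_div_simple_zero hnum hden hnum0 hnum1 hden0
    refine hasPoleFst_of_chart (v := fun t => (u t)⁻¹) hφ ?_ h3 (hau.fun_inv (by simp [huτ, ha0]))
      (by simp only [hnum0, zero_div]) h4 ?_
    · rw [Function.comp_apply, hz, henon_self]
    · filter_upwards [mem_nhdsWithin_of_mem_nhds (hSo.mem_nhds (hψ τ hτ).1),
        mem_nhdsWithin_of_mem_nhds (isOpen_ne.mem_nhds (hne τ hτ hτ0)),
        eventually_ne_of_deriv_ne_zero hau hdu a⁻¹,
        eventually_nhdsNE_ne hau (c := 0) (by simp [huτ, ha0])] with t ht ht0 hta hu0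
      have hne : (u t)⁻¹ ≠ a := by rintro rfl; simp at hta
      rw [Function.comp_apply, (hSP ht).2.2.2.2.1 ht0, henon_of_ne hne]
      congr 2
      have h5 : (1 : ℂ) - a * u t ≠ 0 := by
        intro h
        apply hne
        field_simp
        linear_combination h
      have h6 : (u t)⁻¹ - a = (1 - a * u t) / u t := by field_simp
      rw [h6, inv_div]
      field_simp

end ShearConstruction

namespace ShearConstruction

/-! ### Maps with simple poles that are immersive elsewhere -/

/-- Near `ζ` the map `F` is finite, and it has a nonzero derivative at `ζ`. -/
def IsRegularAt (F : OnePoint ℂ → OnePoint (ℂ × ℂ)) (ζ : ℂ) : Prop :=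
  ∃ (x y : ℂ → ℂ) (x' y' : ℂ), (∀ᶠ w : ℂ in 𝓝 ζ, F w = ((x w, y w) : ℂ × ℂ)) ∧
    HasDerivAt x x' ζ ∧ HasDerivAt y y' ζ ∧ ¬ (x' = 0 ∧ y' = 0)

lemma IsRegularAt.henon {F : OnePoint ℂ → OnePoint (ℂ × ℂ)} {ζ : ℂ} (h : IsRegularAt F ζ) {a : ℂ}
    {ε : ℝ} (hne : henon a ε (F ζ) ≠ ∞) : IsRegularAt (henon a ε ∘ F) ζ := by
  obtain ⟨x, y, x', y', hF, hx, hy, h0⟩ := h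
  have hxa : x ζ ≠ a := by
    intro h
    rw [hF.self_of_nhds, h, henon_self] at hne
    exact hne rfl
  have hxa' := sub_ne_zero.2 hxa
  have hder := hy.fun_add ((hasDerivAt_const ζ (ε : ℂ)).fun_div (hx.sub_const a) hxa')
  refine ⟨fun w => y w + ε / (x w - a), x, _, x', ?_, hder, hx, ?_⟩
  · filter_upwards [hF, hx.continuousAt.eventually_ne hxa] with w hw hwa
    rw [Function.comp_apply, hw, henon_of_ne hwa]
  · rintro ⟨h1, h2⟩
    exact h0 ⟨h2, by simpa [h2] using h1⟩

/-- The state of the construction after `n` shears: `PX` and `PY` are the poles of the first and of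
the second coordinate of `F`. They are all simple, `F` is injective and immersive elsewhere, and
the numbers of poles are consecutive Fibonacci numbers. -/
structure IsStage (n : ℕ) (F : OnePoint ℂ → OnePoint (ℂ × ℂ)) (PX PY : Finset (OnePoint ℂ)) :
    Prop where
  inj : ∀ z w, F z = F w → F z ≠ ∞ → z = w
  eq_infty_iff : ∀ z, F z = ∞ ↔ z ∈ PX ∨ z ∈ PY
  disjoint : Disjoint PX PY
  card_fst : PX.card = Nat.fib (n + 1)
  card_snd : PY.card = Nat.fib n
  pole_fst : ∀ p ∈ PX, HasPoleFst F p
  pole_snd : ∀ p ∈ PY, HasPoleSnd F p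
  map_infty : F ∞ = ∞
  regular : ∀ ζ : ℂ, F ζ ≠ ∞ → IsRegularAt F ζ

lemma isStage_zero : IsStage 0 (OnePoint.map fun z : ℂ => (z, (0 : ℂ))) {∞} ∅ where
  inj z w h hz := by
    induction z using OnePoint.rec with
    | infty => exact (hz rfl).elim
    | coe z =>
      induction w using OnePoint.rec with
      | infty => exact (OnePoint.coe_ne_infty _ h).elim
      | coe w =>
        rw [OnePoint.map_some, OnePoint.map_some, OnePoint.coe_eq_coe, Prod.mk.injEq] at h
        rw [h.1]
  eq_infty_iff z := by
    induction z using OnePoint.rec with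
    | infty => simp
    | coe z => simp
  disjoint := by simp
  card_fst := by simp
  card_snd := by simp
  pole_fst p hp := by
    rw [Finset.mem_singleton.1 hp]
    refine ⟨rfl, invChart, id, fun _ => 0, isOpenEmbedding_invChart, invChart_zero, analyticAt_id,
      analyticAt_const, rfl, by simp, ?_⟩
    filter_upwards [self_mem_nhdsWithin] with t ht
    rw [invChart_of_ne ht]; rfl
  pole_snd p hp := by simp at hp
  map_infty := rfl
  regular ζ _ := ⟨id, fun _ => 0, 1, 0, Eventually.of_forall fun w => rfl, hasDerivAt_id ζ,
    hasDerivAt_const _ _, by simp⟩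

lemma HasPoleFst.exterior_mem_nhds {F : OnePoint ℂ → OnePoint (ℂ × ℂ)} {p : OnePoint ℂ}
    (h : HasPoleFst F p) (R : ℝ) : exterior F R ∈ 𝓝 p := by
  obtain ⟨hp, φ, u, v, hφ, rfl, hu, hv, h0, h1, hF⟩ := h
  rw [← hφ.map_nhds_eq, mem_map]
  have hlim : Tendsto (fun t => ‖(u t)⁻¹‖) (𝓝[≠] 0) atTop := by
    have ht : Tendsto u (𝓝[≠] 0) (𝓝[≠] 0) := by
      refine tendsto_nhdsWithin_iff.2 ⟨?_, eventually_ne_of_deriv_ne_zero hu h1 0⟩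
      have := hu.continuousAt.tendsto
      rw [h0] at this
      exact this.mono_left nhdsWithin_le_nhds
    exact tendsto_norm_cobounded_atTop.comp (tendsto_inv₀_nhdsNE_zero.comp ht)
  have h2 := eventually_nhdsWithin_iff.1 (hF.and (hlim.eventually_gt_atTop R))
  filter_upwards [h2] with t ht
  rcases eq_or_ne t 0 with rfl | ht0
  · exact mem_exterior_of_eq_infty hp
  · obtain ⟨h3, h4⟩ := ht ht0
    refine mem_exterior.2 fun x y hxy => Or.inl ?_
    rw [h3, OnePoint.coe_eq_coe, Prod.mk.injEq] at hxy
    rwa [← hxy.1]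

namespace IsStage

variable {n : ℕ} {F : OnePoint ℂ → OnePoint (ℂ × ℂ)} {PX PY : Finset (OnePoint ℂ)}

lemma exists_coe (h : IsStage n F PX PY) {z : OnePoint ℂ} (hz : F z ≠ ∞) : ∃ ζ : ℂ, z = ζ := by
  induction z using OnePoint.rec with
  | infty => exact (hz h.map_infty).elim
  | coe ζ => exact ⟨ζ, rfl⟩

lemma exists_continuousAt (h : IsStage n F PX PY) {z : OnePoint ℂ} (hz : F z ≠ ∞) :
    ∃ x y : OnePoint ℂ → ℂ, ContinuousAt x z ∧ ContinuousAt y z ∧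
      ∀ᶠ w in 𝓝 z, F w = ((x w, y w) : ℂ × ℂ) := by
  obtain ⟨ζ, rfl⟩ := h.exists_coe hz
  obtain ⟨x, y, x', y', hF, hx, hy, -⟩ := h.regular ζ hz
  refine ⟨fun w => w.elim 0 x, fun w => w.elim 0 y, ?_, ?_, ?_⟩
  · exact OnePoint.continuousAt_coe.2 hx.continuousAt
  · exact OnePoint.continuousAt_coe.2 hy.continuousAt
  · rw [OnePoint.nhds_coe_eq, eventually_map]
    exact hF

lemma isOpen_exterior (h : IsStage n F PX PY) (R : ℝ) : IsOpen (exterior F R) := by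
  rw [isOpen_iff_mem_nhds]
  intro z hz
  by_cases hzi : F z = ∞
  · rcases (h.eq_infty_iff z).1 hzi with hp | hp
    · exact (h.pole_fst z hp).exterior_mem_nhds R
    · rw [← exterior_swap]
      exact HasPoleFst.exterior_mem_nhds (h.pole_snd z hp) R
  · obtain ⟨x, y, hx, hy, hF⟩ := h.exists_continuousAt hzi
    rcases mem_exterior.1 hz _ _ hF.self_of_nhds with h1 | h1
    · filter_upwards [hF, continuousAt_const.eventually_lt hx.norm h1] with w hw hw1
      refine mem_exterior.2 fun x' y' hxy => Or.inl ?_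
      rw [hw, OnePoint.coe_eq_coe, Prod.mk.injEq] at hxy
      rwa [← hxy.1]
    · filter_upwards [hF, continuousAt_const.eventually_lt hy.norm h1] with w hw hw1
      refine mem_exterior.2 fun x' y' hxy => Or.inr ?_
      rw [hw, OnePoint.coe_eq_coe, Prod.mk.injEq] at hxy
      rwa [← hxy.2]

lemma mem_nhds_of_norm_lt (h : IsStage n F PX PY) {R : ℝ} {z : OnePoint ℂ} {x y : ℂ}
    (hz : F z = ((x, y) : ℂ × ℂ)) (hx : ‖x‖ < R) (hy : ‖y‖ < R) : (exterior F R)ᶜ ∈ 𝓝 z := by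
  obtain ⟨X, Y, hX, hY, hF⟩ :=
    h.exists_continuousAt (z := z) (by rw [hz]; exact OnePoint.coe_ne_infty _)
  have h1 := hF.self_of_nhds
  rw [hz, OnePoint.coe_eq_coe, Prod.mk.injEq] at h1
  rw [h1.1] at hx
  rw [h1.2] at hy
  filter_upwards [hF, hX.norm.eventually_lt continuousAt_const hx,
    hY.norm.eventually_lt continuousAt_const hy] with w hw hw1 hw2
  exact notMem_exterior.2 ⟨_, _, hw, hw1.le, hw2.le⟩

lemma exists_bound (h : IsStage n F PX PY) {K : Set (OnePoint ℂ)} (hK : IsCompact K)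
    (hKF : ∀ z ∈ K, F z ≠ ∞) : ∃ M : ℝ, ∀ z ∈ K, z ∉ exterior F M := by
  have hmono : ∀ {M M' : ℝ} {z}, M ≤ M' → z ∉ exterior F M → z ∉ exterior F M' := by
    intro M M' z hM hz
    obtain ⟨x, y, h1, h2, h3⟩ := notMem_exterior.1 hz
    exact notMem_exterior.2 ⟨x, y, h1, h2.trans hM, h3.trans hM⟩
  refine hK.induction_on (p := fun s => ∃ M : ℝ, ∀ z ∈ s, z ∉ exterior F M) ⟨0, by simp⟩ ?_ ?_ ?_
  · rintro s t hst ⟨M, hM⟩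
    exact ⟨M, fun z hz => hM z (hst hz)⟩
  · rintro s t ⟨M, hM⟩ ⟨M', hM'⟩
    refine ⟨max M M', ?_⟩
    rintro z (hz | hz)
    · exact hmono (le_max_left _ _) (hM z hz)
    · exact hmono (le_max_right _ _) (hM' z hz)
  · intro z hz
    obtain ⟨x, y, -, -, hF⟩ := h.exists_continuousAt (hKF z hz)
    have h1 := hF.self_of_nhds
    refine ⟨_, mem_nhdsWithin_of_mem_nhds (h.mem_nhds_of_norm_lt (R := max ‖x z‖ ‖y z‖ + 1) h1 ?_ ?_),
      max ‖x z‖ ‖y z‖ + 1, fun w hw => hw⟩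
    · linarith [le_max_left ‖x z‖ ‖y z‖]
    · linarith [le_max_right ‖x z‖ ‖y z‖]

end IsStage

lemma sphDist_lt_mem_nhds (p : OnePoint ℂ) {δ : ℝ} (hδ : 0 < δ) :
    {z | sphDist z p < δ} ∈ 𝓝 p :=
  @Metric.ball_mem_nhds _ sphMetric.toPseudoMetricSpace p δ hδ

/-- Disjoint small neighbourhoods `N p` of the poles, as in `IsPoleNhd`, which together contain
everything that `F` sends outside the bidisc of radius `R`. -/
structure IsSeparation (F : OnePoint ℂ → OnePoint (ℂ × ℂ)) (PX PY : Finset (OnePoint ℂ))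
    (N : OnePoint ℂ → Set (OnePoint ℂ)) (R δ : ℝ) : Prop where
  fst : ∀ p ∈ PX, IsPoleNhd F p (N p) R
  snd : ∀ p ∈ PY, IsPoleNhd (swapInfty ∘ F) p (N p) R
  disj : ∀ p q, (p ∈ PX ∨ p ∈ PY) → (q ∈ PX ∨ q ∈ PY) → p ≠ q → Disjoint (N p) (N q)
  cover : ∀ z ∈ exterior F R, ∃ p, (p ∈ PX ∨ p ∈ PY) ∧ z ∈ N p
  small : ∀ p, (p ∈ PX ∨ p ∈ PY) → ∀ z ∈ N p, ∀ w ∈ N p, sphDist z w ≤ δ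

/-- Every large radius is admissible: off small neighbourhoods of the poles the map is bounded by
compactness. -/
theorem IsStage.exists_isSeparation {n : ℕ} {F : OnePoint ℂ → OnePoint (ℂ × ℂ)}
    {PX PY : Finset (OnePoint ℂ)} (h : IsStage n F PX PY) {δ : ℝ} (hδ : 0 < δ) :
    ∃ (N : OnePoint ℂ → Set (OnePoint ℂ)) (R₀ : ℝ), ∀ R ≥ R₀, IsSeparation F PX PY N R δ := by
  classical
  obtain ⟨V, hV, hVd⟩ := (PX ∪ PY).finite_toSet.t2_separation
  have hloc : ∀ p, ∃ N ⊆ V p ∩ {z | sphDist z p < δ / 2}, ∃ R₀ : ℝ, ∀ R ≥ R₀,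
      (p ∈ PX → IsPoleNhd F p N R) ∧ (p ∈ PY → IsPoleNhd (swapInfty ∘ F) p N R) := by
    intro p
    have hU : V p ∩ {z | sphDist z p < δ / 2} ∈ 𝓝 p :=
      inter_mem ((hV p).2.mem_nhds (hV p).1) (sphDist_lt_mem_nhds p (half_pos hδ))
    by_cases hX : p ∈ PX
    · have hY : p ∉ PY := Finset.disjoint_left.1 h.disjoint hX
      obtain ⟨N, hN, R₀, hR⟩ := (h.pole_fst p hX).exists_isPoleNhd hU
      exact ⟨N, hN, R₀, fun R hR' => ⟨fun _ => hR R hR', fun h => (hY h).elim⟩⟩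
    · by_cases hY : p ∈ PY
      · obtain ⟨N, hN, R₀, hR⟩ := HasPoleFst.exists_isPoleNhd (h.pole_snd p hY) hU
        exact ⟨N, hN, R₀, fun R hR' => ⟨fun h => (hX h).elim, fun _ => hR R hR'⟩⟩
      · exact ⟨∅, empty_subset _, 0, fun R _ => ⟨fun h => (hX h).elim, fun h => (hY h).elim⟩⟩
  choose N hNU R₀ hN using hloc
  obtain ⟨M₁, hM₁⟩ := ((PX ∪ PY).image R₀).exists_le
  have hopen : ∀ p ∈ PX ∪ PY, IsOpen (N p) ∧ p ∈ N p := by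
    intro p hp
    rcases Finset.mem_union.1 hp with hp | hp
    · exact ⟨((hN p _ le_rfl).1 hp).isOpen, ((hN p _ le_rfl).1 hp).mem⟩
    · exact ⟨((hN p _ le_rfl).2 hp).isOpen, ((hN p _ le_rfl).2 hp).mem⟩
  have hK : IsCompact (⋃ p ∈ PX ∪ PY, N p)ᶜ :=
    (isOpen_biUnion fun p hp => (hopen p hp).1).isClosed_compl.isCompact
  obtain ⟨M₂, hM₂⟩ := h.exists_bound hK (by
    intro z hz hzi
    refine hz (mem_biUnion (x := z) ?_ (hopen z ?_).2) <;>
    exact Finset.mem_union.2 ((h.eq_infty_iff z).1 hzi))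
  refine ⟨N, max M₁ M₂, fun R hR => ?_⟩
  have hR₁ : ∀ p, p ∈ PX ∨ p ∈ PY → R₀ p ≤ R := fun p hp =>
    (hM₁ _ (Finset.mem_image_of_mem _ (Finset.mem_union.2 hp))).trans ((le_max_left _ _).trans hR)
  constructor
  · exact fun p hp => (hN p R (hR₁ p (Or.inl hp))).1 hp
  · exact fun p hp => (hN p R (hR₁ p (Or.inr hp))).2 hp
  · intro p q hp hq hpq
    exact (hVd (Finset.mem_coe.2 (Finset.mem_union.2 hp)) (Finset.mem_coe.2 (Finset.mem_union.2 hq))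
      hpq).mono ((hNU p).trans inter_subset_left) ((hNU q).trans inter_subset_left)
  · intro z hz
    by_contra hcon
    have hzK : z ∈ (⋃ p ∈ PX ∪ PY, N p)ᶜ := by
      simp only [mem_compl_iff, mem_iUnion, not_exists, Finset.mem_union]
      exact fun p hp hzp => hcon ⟨p, hp, hzp⟩
    obtain ⟨x, y, h1, h2, h3⟩ := notMem_exterior.1 (hM₂ z hzK)
    have hRM : M₂ ≤ R := (le_max_right _ _).trans hR
    exact notMem_exterior.2 ⟨x, y, h1, h2.trans hRM, h3.trans hRM⟩ hz
  · intro p _ z hz w hw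
    have h1 : sphDist z p < δ / 2 := (hNU p hz).2
    have h2 : sphDist w p < δ / 2 := (hNU p hw).2
    rw [sphDist_comm] at h2
    linarith [sphDist_triangle z p w]

lemma henon_inj {a : ℂ} {ε : ℝ} {p q : OnePoint (ℂ × ℂ)} (h : henon a ε p = henon a ε q)
    (hp : henon a ε p ≠ ∞) : p = q := by
  have hq : henon a ε q ≠ ∞ := h ▸ hp
  induction p using OnePoint.rec with
  | infty => exact (hp rfl).elim
  | coe p =>
    induction q using OnePoint.rec with
    | infty => exact (hq rfl).elim
    | coe q =>
      obtain ⟨x, y⟩ := p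
      obtain ⟨x', y'⟩ := q
      have hx : x ≠ a := by rintro rfl; exact hp (henon_self _ _ _)
      have hx' : x' ≠ a := by rintro rfl; exact hq (henon_self _ _ _)
      rw [henon_of_ne hx, henon_of_ne hx', OnePoint.coe_eq_coe, Prod.mk.injEq] at h
      obtain ⟨h1, rfl⟩ := h
      rw [add_right_cancel h1]

lemma henon_eq_infty {a : ℂ} {ε : ℝ} {p : OnePoint (ℂ × ℂ)} :
    henon a ε p = ∞ ↔ p = ∞ ∨ ∃ y : ℂ, p = ((a, y) : ℂ × ℂ) := by
  constructor
  · intro h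
    induction p using OnePoint.rec with
    | infty => exact Or.inl rfl
    | coe p =>
      obtain ⟨x, y⟩ := p
      by_cases hx : x = a
      · exact Or.inr ⟨y, by rw [hx]⟩
      · rw [henon_of_ne hx] at h
        exact (OnePoint.coe_ne_infty _ h).elim
  · rintro (rfl | ⟨y, rfl⟩)
    · rfl
    · exact henon_self _ _ _

/-- One more shear: the old poles stay, exchanging their roles, and one new pole appears next to
every pole of the first coordinate. -/
theorem IsStage.exists_succ {n : ℕ} {F : OnePoint ℂ → OnePoint (ℂ × ℂ)}
    {PX PY : Finset (OnePoint ℂ)} (h : IsStage n F PX PY) {N : OnePoint ℂ → Set (OnePoint ℂ)}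
    {R δ : ℝ} (hN : IsSeparation F PX PY N R δ) {a : ℂ} (ha : R < ‖a‖) {ε : ℝ} (hε : ε ≠ 0) :
    ∃ PX' : Finset (OnePoint ℂ), IsStage (n + 1) (henon a ε ∘ F) PX' PX ∧ PY ⊆ PX' ∧
      ∀ p ∈ PX, ∃ q ∈ PX', q ≠ p ∧ q ∈ N p ∩ exterior F R := by
  classical
  have hex : ∀ p, ∃ q, p ∈ PX → q ∈ N p ∧ ∃ y : ℂ, F q = ((a, y) : ℂ × ℂ) := by
    intro p
    by_cases hp : p ∈ PX
    · obtain ⟨z, hz, y, hy⟩ := (hN.fst p hp).exists_fst a ha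
      exact ⟨z, fun _ => ⟨hz, y, hy⟩⟩
    · exact ⟨∞, fun h => (hp h).elim⟩
  choose q hq using hex
  have hfin : ∀ z, (∃ y : ℂ, F z = ((a, y) : ℂ × ℂ)) → F z ≠ ∞ := by
    rintro z ⟨y, hy⟩
    rw [hy]; exact OnePoint.coe_ne_infty _
  have hext : ∀ z, (∃ y : ℂ, F z = ((a, y) : ℂ × ℂ)) → z ∈ exterior F R := by
    rintro z ⟨y, hy⟩
    refine mem_exterior.2 fun x' y' hxy => Or.inl ?_
    rw [hy, OnePoint.coe_eq_coe, Prod.mk.injEq] at hxy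
    rwa [← hxy.1]
  have hnew : ∀ z, (∃ y : ℂ, F z = ((a, y) : ℂ × ℂ)) ↔ z ∈ PX.image q := by
    intro z
    constructor
    · intro hz
      obtain ⟨y, hy⟩ := hz
      obtain ⟨p, hp | hp, hzp⟩ := hN.cover z (hext z ⟨y, hy⟩)
      · obtain ⟨h1, y', h2⟩ := hq p hp
        exact Finset.mem_image.2 ⟨p, hp, (hN.fst p hp).fst_inj a y' y _ h1 _ hzp h2 hy⟩
      · refine absurd ((hN.snd p hp).snd_le z hzp y a ?_) ha.not_ge
        rw [Function.comp_apply, hy, swapInfty_coe]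
    · intro hz
      obtain ⟨p, hp, rfl⟩ := Finset.mem_image.1 hz
      exact (hq p hp).2
  have hpoleN : ∀ p ∈ PX, p ∈ N p := fun p hp => (hN.fst p hp).mem
  have hinjq : Set.InjOn q PX := by
    intro p hp p' hp' heq
    by_contra hne
    exact (hN.disj p p' (Or.inl hp) (Or.inl hp') hne).le_bot
      ⟨(hq p hp).1, by rw [heq]; exact (hq p' hp').1⟩
  have hdisj : Disjoint PY (PX.image q) := by
    rw [Finset.disjoint_left]
    intro z hz hz'
    exact hfin z ((hnew z).2 hz') ((h.eq_infty_iff z).2 (Or.inr hz))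
  refine ⟨PY ∪ PX.image q, ?_, Finset.subset_union_left, ?_⟩
  · constructor
    · intro z w hzw hz
      have h1 := henon_inj hzw hz
      refine h.inj z w h1 fun h2 => hz ?_
      rw [Function.comp_apply, h2, henon_infty]
    · intro z
      rw [Function.comp_apply, henon_eq_infty, h.eq_infty_iff, hnew, Finset.mem_union]
      tauto
    · rw [Finset.disjoint_union_left]
      refine ⟨h.disjoint.symm, ?_⟩
      rw [Finset.disjoint_left]
      intro z hz hz'
      exact hfin z ((hnew z).2 hz) ((h.eq_infty_iff z).2 (Or.inl hz'))
    · rw [Finset.card_union_of_disjoint hdisj, Finset.card_image_of_injOn hinjq, h.card_fst,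
        h.card_snd, Nat.fib_add_two]
    · exact h.card_fst
    · intro p hp
      rcases Finset.mem_union.1 hp with hp | hp
      · refine (h.pole_snd p hp).henon ε (R := R) ?_ ha
        filter_upwards [(hN.snd p hp).isOpen.mem_nhds (hN.snd p hp).mem] with z hz x y hxy
        refine (hN.snd p hp).snd_le z hz y x ?_
        rw [Function.comp_apply, hxy, swapInfty_coe]
      · obtain ⟨p', hp', rfl⟩ := Finset.mem_image.1 hp
        obtain ⟨h1, y, h2⟩ := hq p' hp'
        exact (hN.fst p' hp').new_pole a y ha _ h1 h2 ε hε
    · exact fun p hp => (h.pole_fst p hp).henon a ε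
    · rw [Function.comp_apply, h.map_infty, henon_infty]
    · intro ζ hζ
      refine (h.regular ζ fun h1 => hζ ?_).henon hζ
      rw [Function.comp_apply, h1, henon_infty]
  · intro p hp
    obtain ⟨h1, h2⟩ := hq p hp
    refine ⟨q p, Finset.mem_union_right _ (Finset.mem_image_of_mem _ hp), fun heq => ?_, h1,
      hext _ h2⟩
    exact hfin _ h2 (by rw [heq]; exact (h.eq_infty_iff p).2 (Or.inl hp))

namespace IsSeparation

variable {F : OnePoint ℂ → OnePoint (ℂ × ℂ)} {PX PY : Finset (OnePoint ℂ)}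
  {N : OnePoint ℂ → Set (OnePoint ℂ)} {R δ : ℝ}

lemma isOpen (hN : IsSeparation F PX PY N R δ) {p : OnePoint ℂ} (hp : p ∈ PX ∨ p ∈ PY) :
    IsOpen (N p) := by
  rcases hp with hp | hp
  exacts [(hN.fst p hp).isOpen, (hN.snd p hp).isOpen]

lemma mem (hN : IsSeparation F PX PY N R δ) {p : OnePoint ℂ} (hp : p ∈ PX ∨ p ∈ PY) : p ∈ N p := by
  rcases hp with hp | hp
  exacts [(hN.fst p hp).mem, (hN.snd p hp).mem]

lemma isPreconnected (hN : IsSeparation F PX PY N R δ) {p : OnePoint ℂ} (hp : p ∈ PX ∨ p ∈ PY) :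
    IsPreconnected (N p ∩ exterior F R) := by
  rcases hp with hp | hp
  · exact (hN.fst p hp).isPreconnected
  · rw [← exterior_swap]; exact (hN.snd p hp).isPreconnected

lemma eq_of_infty (hN : IsSeparation F PX PY N R δ) {p : OnePoint ℂ} (hp : p ∈ PX ∨ p ∈ PY)
    {z : OnePoint ℂ} (hz : z ∈ N p) (h : F z = ∞) : z = p := by
  rcases hp with hp | hp
  · exact (hN.fst p hp).eq_of_infty z hz h
  · exact (hN.snd p hp).eq_of_infty z hz (swapInfty_eq_infty.2 h)

lemma subset_of_isPreconnected (hN : IsSeparation F PX PY N R δ) {p : OnePoint ℂ}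
    (hp : p ∈ PX ∨ p ∈ PY) {s : Set (OnePoint ℂ)} (hs : IsPreconnected s)
    (hsub : s ⊆ exterior F R) (hne : (s ∩ N p).Nonempty) : s ⊆ N p := by
  refine IsPreconnected.subset_left_of_subset_union (v := ⋃ q ∈ {q | (q ∈ PX ∨ q ∈ PY) ∧ p ≠ q}, N q)
    (hN.isOpen hp) (isOpen_biUnion fun q hq => hN.isOpen hq.1) ?_ ?_ hne hs
  · exact disjoint_iUnion₂_right.2 fun q hq => hN.disj p q hp hq.1 hq.2
  · intro w hw
    obtain ⟨q, hq, hwq⟩ := hN.cover w (hsub hw)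
    rcases eq_or_ne p q with rfl | hpq
    · exact Or.inl hwq
    · exact Or.inr (mem_biUnion (show q ∈ {q | (q ∈ PX ∨ q ∈ PY) ∧ p ≠ q} from ⟨hq, hpq⟩) hwq)

lemma connectedComponentIn_eq (hN : IsSeparation F PX PY N R δ) {p z : OnePoint ℂ}
    (hp : p ∈ PX ∨ p ∈ PY) (hz : z ∈ N p) (hzR : z ∈ exterior F R) :
    connectedComponentIn (exterior F R) z = N p ∩ exterior F R := by
  refine Subset.antisymm (subset_inter ?_ (connectedComponentIn_subset _ _))
    ((hN.isPreconnected hp).subset_connectedComponentIn ⟨hz, hzR⟩ inter_subset_right)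
  exact hN.subset_of_isPreconnected hp isPreconnected_connectedComponentIn
    (connectedComponentIn_subset _ _) ⟨z, mem_connectedComponentIn hzR, hz⟩

lemma existsUnique_pole (hN : IsSeparation F PX PY N R δ)
    (hF : ∀ z, F z = ∞ ↔ z ∈ PX ∨ z ∈ PY) {z : OnePoint ℂ} (hz : z ∈ exterior F R) :
    (∃! p, p ∈ connectedComponentIn (exterior F R) z ∧ F p = ∞) ∧
      sphDiam (connectedComponentIn (exterior F R) z) ≤ δ := by
  obtain ⟨p, hp, hzp⟩ := hN.cover z hz
  have hpF := (hF p).2 hp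
  rw [hN.connectedComponentIn_eq hp hzp hz]
  refine ⟨⟨p, ⟨⟨hN.mem hp, mem_exterior_of_eq_infty hpF⟩, hpF⟩, ?_⟩, ?_⟩
  · rintro q ⟨⟨hq, -⟩, hqF⟩
    exact hN.eq_of_infty hp hq hqF
  · have hδ : 0 ≤ δ := by
      have := hN.small p hp p (hN.mem hp) p (hN.mem hp)
      rwa [sphDist_self] at this
    exact @Metric.diam_le_of_forall_dist_le _ _ sphMetric.toPseudoMetricSpace _ hδ
      fun x hx y hy => hN.small p hp x hx.1 y hy.1

end IsSeparation

/-! ### The recursive choice of the radii -/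

/-- The parameters `εₙ`. -/
noncomputable def eps (n : ℕ) : ℝ := (1 / 2) ^ (n + 2)

/-- Bound imposed on the diameters of the components of `Δₙ`; the factor `1 / 2` makes the bound
of the theorem strict. -/
noncomputable def mesh (n : ℕ) : ℝ := 1 / (b n : ℝ) ^ n / 2

lemma b_pos (n : ℕ) : 0 < b n := Nat.fib_pos.2 (by omega)

lemma mesh_pos (n : ℕ) : 0 < mesh n := by
  have : (0 : ℝ) < b n := by exact_mod_cast b_pos n
  unfold mesh; positivity

lemma mesh_lt (n : ℕ) : mesh n < 1 / (b n : ℝ) ^ n := by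
  have := mesh_pos n
  unfold mesh at *; linarith

lemma eps_pos (n : ℕ) : 0 < eps n := by unfold eps; positivity

/-- The data attached to the `n`-th stage of the construction. -/
structure StageData (n : ℕ) where
  /-- The map `γₙ`, up to an exchange of coordinates. -/
  F : OnePoint ℂ → OnePoint (ℂ × ℂ)
  /-- The poles of the first coordinate. -/
  PX : Finset (OnePoint ℂ)
  /-- The poles of the second coordinate. -/
  PY : Finset (OnePoint ℂ)
  /-- The neighbourhoods of the poles. -/
  N : OnePoint ℂ → Set (OnePoint ℂ)
  /-- The radius of the bidisc. -/
  R : ℝ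
  R_pos : 0 < R
  isStage : IsStage n F PX PY
  isSeparation : IsSeparation F PX PY N R (mesh n)

/-- How consecutive stages are related. -/
structure StageData.IsSucc {n : ℕ} (s : StageData n) (t : StageData (n + 1)) : Prop where
  F_eq : t.F = henon ((s.R + 1 : ℝ) : ℂ) (eps (n + 1)) ∘ s.F
  PY_eq : t.PY = s.PX
  PX_sub : s.PY ⊆ t.PX
  R_le : s.R + 2 ≤ t.R
  new_pole : ∀ p ∈ s.PX, ∃ q ∈ t.PX, q ≠ p ∧ q ∈ s.N p ∩ exterior s.F s.R

lemma StageData.exists_zero :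
    ∃ s : StageData 0, s.F = OnePoint.map fun z : ℂ => (z, (0 : ℂ)) := by
  obtain ⟨N, R₀, hN⟩ := isStage_zero.exists_isSeparation (mesh_pos 0)
  exact ⟨⟨_, _, _, N, max R₀ 1, lt_max_of_lt_right one_pos, isStage_zero, hN _ (le_max_left _ _)⟩,
    rfl⟩

lemma norm_add_one {R : ℝ} (hR : 0 < R) : ‖((R + 1 : ℝ) : ℂ)‖ = R + 1 := by
  rw [Complex.norm_real, Real.norm_of_nonneg (by linarith)]

lemma StageData.exists_succ {n : ℕ} (s : StageData n) : ∃ t : StageData (n + 1), s.IsSucc t := by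
  obtain ⟨PX', hst, hsub, hnew⟩ := s.isStage.exists_succ s.isSeparation
    (a := ((s.R + 1 : ℝ) : ℂ)) (by rw [norm_add_one s.R_pos]; linarith) (eps_pos (n + 1)).ne'
  obtain ⟨N, R₀, hN⟩ := hst.exists_isSeparation (mesh_pos (n + 1))
  have := s.R_pos
  exact ⟨⟨_, PX', s.PX, N, max R₀ (s.R + 2), lt_max_of_lt_right (by linarith), hst,
    hN _ (le_max_left _ _)⟩, rfl, rfl, hsub, le_max_right _ _, hnew⟩

theorem exists_stageData : ∃ s : ∀ n, StageData n,
    ((s 0).F = OnePoint.map fun z : ℂ => (z, (0 : ℂ))) ∧ ∀ n, (s n).IsSucc (s (n + 1)) := by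
  obtain ⟨s₀, h₀⟩ := StageData.exists_zero
  choose next hnext using fun n (s : StageData n) => s.exists_succ
  exact ⟨fun n => Nat.rec s₀ next n, h₀, fun n => hnext n _⟩

end ShearConstruction

namespace ShearConstruction

/-! ### Comparison of consecutive maps -/

/-- The parity-dependent exchange of coordinates which relates the maps `γₙ` to the iterates of
the maps `henon a ε`. -/
def parity (n : ℕ) : ℂ × ℂ → ℂ × ℂ := if Even n then id else Prod.swap

lemma parity_zero : parity 0 = id := if_pos Even.zero

lemma parity_succ (n : ℕ) (p : ℂ × ℂ) : parity (n + 1) p = parity n p.swap := by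
  unfold parity
  by_cases h : Even n
  · simp [h, Nat.even_add_one]
  · simp [h, Nat.even_add_one]

lemma dist_parity (n : ℕ) (p q : ℂ × ℂ) : dist (parity n p) (parity n q) = dist p q := by
  unfold parity
  split_ifs
  · rfl
  · simp [Prod.dist_eq, max_comm]

lemma norm_parity (n : ℕ) (p : ℂ × ℂ) : ‖parity n p‖ = ‖p‖ := by
  unfold parity
  split_ifs
  · rfl
  · simp [Prod.norm_def, max_comm]

lemma shear_map_parity (n : ℕ) (a : ℂ) (ε : ℝ) (p : OnePoint (ℂ × ℂ)) :
    shear (n + 1) a ε (OnePoint.map (parity n) p) = OnePoint.map (parity (n + 1)) (henon a ε p) := by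
  induction p using OnePoint.rec with
  | infty => rfl
  | coe p =>
    obtain ⟨x, y⟩ := p
    rw [OnePoint.map_some, henon_coe]
    by_cases hn : Even n
    · have h1 : Odd (n + 1) := hn.add_one
      have h2 : ¬ Even (n + 1) := Nat.not_even_iff_odd.2 h1
      simp only [parity, hn, h2, if_true, if_false, id_eq, shear, h1]
      split_ifs <;> rfl
    · have h2 : Even (n + 1) := Nat.even_add_one.2 hn
      have h1 : ¬ Odd (n + 1) := Nat.not_odd_iff_even.2 h2
      simp only [parity, hn, h2, if_true, if_false, Prod.swap_prod_mk, shear, h1]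
      split_ifs <;> rfl

/-- A sequence of stages, each of which is obtained from the preceding one by a shear. -/
structure IsConstruction (s : ∀ n, StageData n) : Prop where
  zero : (s 0).F = OnePoint.map fun z : ℂ => (z, (0 : ℂ))
  succ : ∀ n, (s n).IsSucc (s (n + 1))

/-- The parameters `aₙ`. -/
noncomputable def center (s : ∀ n, StageData n) (n : ℕ) : ℂ := (((s (n - 1)).R + 1 : ℝ) : ℂ)

/-- The parameters `Rₙ`. -/
def radius (s : ∀ n, StageData n) (n : ℕ) : ℝ := (s n).R

/-- The finite part of `γₙ`. -/
noncomputable def gamma (s : ∀ n, StageData n) (n : ℕ) (z : OnePoint ℂ) : ℂ × ℂ :=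
  finitePart (gammaSeq (center s) eps n z)

/-- The set `Δₙ`. -/
def domain (s : ∀ n, StageData n) (n : ℕ) : Set (OnePoint ℂ) := exterior (s n).F (s n).R

/-- The limit of the maps `γₙ`, where it exists. -/
noncomputable def limitMap (s : ∀ n, StageData n) (z : OnePoint ℂ) : ℂ × ℂ :=
  limUnder atTop fun n => gamma s n z

namespace IsConstruction

variable {s : ∀ n, StageData n}

lemma gammaSeq_eq (h : IsConstruction s) (n : ℕ) (z : OnePoint ℂ) :
    gammaSeq (center s) eps n z = OnePoint.map (parity n) ((s n).F z) := by
  induction n with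
  | zero =>
    rw [h.zero, parity_zero, OnePoint.map_id]
    rfl
  | succ n ih =>
    rw [gammaSeq, Function.comp_apply, ih, shear_map_parity, (h.succ n).F_eq]
    rfl

lemma gamma_eq (h : IsConstruction s) {n : ℕ} {z : OnePoint ℂ} {x y : ℂ}
    (hz : (s n).F z = ((x, y) : ℂ × ℂ)) : gamma s n z = parity n (x, y) := by
  rw [gamma, h.gammaSeq_eq, hz]; rfl

lemma gammaSeq_eq_infty (h : IsConstruction s) {n : ℕ} {z : OnePoint ℂ} :
    gammaSeq (center s) eps n z = ∞ ↔ (s n).F z = ∞ := by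
  rw [h.gammaSeq_eq]
  induction (s n).F z using OnePoint.rec <;> simp

lemma delta_eq (h : IsConstruction s) (n : ℕ) :
    Delta (center s) eps (radius s) n = domain s n := by
  change exterior (gammaSeq (center s) eps n) (s n).R = exterior (s n).F (s n).R
  rw [show gammaSeq (center s) eps n = OnePoint.map (parity n) ∘ (s n).F from
    funext (h.gammaSeq_eq n)]
  by_cases hn : Even n
  · simp [parity, hn, OnePoint.map_id]
  · rw [← exterior_swap (s n).F]
    simp [parity, hn, swapInfty]

lemma step_ne {R : ℝ} {x : ℂ} (hx : ‖x‖ ≤ R) :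
    1 ≤ ‖x - ((R + 1 : ℝ) : ℂ)‖ ∧ x ≠ ((R + 1 : ℝ) : ℂ) := by
  have hR : 0 ≤ R := (norm_nonneg x).trans hx
  have h2 : ‖((R + 1 : ℝ) : ℂ)‖ = R + 1 := by
    rw [Complex.norm_real, Real.norm_of_nonneg (by linarith)]
  have h1 : 1 ≤ ‖x - ((R + 1 : ℝ) : ℂ)‖ := by
    have := norm_sub_norm_le ((R + 1 : ℝ) : ℂ) x
    rw [norm_sub_rev, h2] at this
    linarith
  refine ⟨h1, fun h => ?_⟩
  rw [h, sub_self, norm_zero] at h1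
  linarith

lemma norm_step_le {R : ℝ} {x : ℂ} (hx : ‖x‖ ≤ R) {ε : ℝ} (hε : 0 < ε) :
    ‖(ε : ℂ) / (x - ((R + 1 : ℝ) : ℂ))‖ ≤ ε := by
  rw [norm_div, Complex.norm_real, Real.norm_of_nonneg hε.le]
  exact div_le_self hε.le (step_ne hx).1

lemma F_succ (h : IsConstruction s) {n : ℕ} {z : OnePoint ℂ} {x y : ℂ}
    (hz : (s n).F z = ((x, y) : ℂ × ℂ)) (hx : ‖x‖ ≤ (s n).R) : (s (n + 1)).F z =
      ((y + eps (n + 1) / (x - (((s n).R + 1 : ℝ) : ℂ)), x) : ℂ × ℂ) := by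
  rw [(h.succ n).F_eq, Function.comp_apply, hz, henon_of_ne (step_ne hx).2]

lemma eps_le_one (n : ℕ) : eps n ≤ 1 / 4 := by
  unfold eps
  rw [pow_add]
  have : ((1 : ℝ) / 2) ^ n ≤ 1 := pow_le_one₀ (by norm_num) (by norm_num)
  linarith

/-- Points sent by `γₙ` into the closed bidisc of radius `Rₙ` are sent by `γₙ₊₁` into the open one
of radius `Rₙ₊₁`, because `Rₙ₊₁ ≥ Rₙ + 2` and the shear moves them by at most `εₙ₊₁`. -/
lemma bound_succ (h : IsConstruction s) {n : ℕ} {z : OnePoint ℂ} (hz : z ∉ domain s n) :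
    ∃ x y : ℂ, (s (n + 1)).F z = ((x, y) : ℂ × ℂ) ∧ ‖x‖ < (s (n + 1)).R ∧ ‖y‖ < (s (n + 1)).R := by
  obtain ⟨x, y, h1, h2, h3⟩ := notMem_exterior.1 hz
  have hR := (h.succ n).R_le
  refine ⟨_, _, h.F_succ h1 h2, ?_, by linarith⟩
  have h4 := norm_add_le y (eps (n + 1) / (x - (((s n).R + 1 : ℝ) : ℂ)))
  have h5 := norm_step_le h2 (eps_pos (n + 1))
  have h6 := eps_le_one (n + 1)
  linarith

lemma domain_succ_subset (h : IsConstruction s) (n : ℕ) : domain s (n + 1) ⊆ domain s n := by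
  intro z hz
  by_contra hcon
  obtain ⟨x, y, h1, h2, h3⟩ := h.bound_succ hcon
  exact notMem_exterior.2 ⟨x, y, h1, h2.le, h3.le⟩ hz

lemma antitone_domain (h : IsConstruction s) : Antitone (domain s) :=
  antitone_nat_of_succ_le h.domain_succ_subset

lemma isOpen_domain (n : ℕ) : IsOpen (domain s n) := (s n).isStage.isOpen_exterior _

lemma compl_domain_succ_mem_nhds (h : IsConstruction s) {n : ℕ} {z : OnePoint ℂ}
    (hz : z ∉ domain s n) : (domain s (n + 1))ᶜ ∈ 𝓝 z := by
  obtain ⟨x, y, h1, h2, h3⟩ := h.bound_succ hz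
  exact (s (n + 1)).isStage.mem_nhds_of_norm_lt h1 h2 h3

lemma dist_gamma_succ (h : IsConstruction s) {n : ℕ} {z : OnePoint ℂ} (hz : z ∉ domain s n) :
    dist (gamma s n z) (gamma s (n + 1) z) ≤ eps (n + 1) := by
  obtain ⟨x, y, h1, h2, h3⟩ := notMem_exterior.1 hz
  rw [h.gamma_eq h1, h.gamma_eq (h.F_succ h1 h2), parity_succ, dist_parity, Prod.swap_prod_mk,
    Prod.dist_eq]
  simpa [(eps_pos (n + 1)).le] using norm_step_le h2 (eps_pos (n + 1))

/-- On the bidisc of radius `Rₙ` the next shear contracts distances very little. -/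
lemma dist_gamma_succ_ge (h : IsConstruction s) {n : ℕ} {z w : OnePoint ℂ} (hz : z ∉ domain s n)
    (hw : w ∉ domain s n) : (1 - eps (n + 1)) * dist (gamma s n z) (gamma s n w) ≤
      dist (gamma s (n + 1) z) (gamma s (n + 1) w) := by
  obtain ⟨x, y, h1, h2, -⟩ := notMem_exterior.1 hz
  obtain ⟨x', y', h1', h2', -⟩ := notMem_exterior.1 hw
  rw [h.gamma_eq h1, h.gamma_eq (h.F_succ h1 h2), h.gamma_eq h1', h.gamma_eq (h.F_succ h1' h2'),
    dist_parity, dist_parity]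
  set a := (((s n).R + 1 : ℝ) : ℂ) with ha
  set ε := eps (n + 1) with hε
  have hε0 : 0 < ε := eps_pos (n + 1)
  have hε1 : ε ≤ 1 / 4 := eps_le_one (n + 1)
  obtain ⟨h4, h5⟩ := step_ne h2
  obtain ⟨h4', h5'⟩ := step_ne h2'
  have h6 : x - a ≠ 0 := sub_ne_zero.2 h5
  have h6' : x' - a ≠ 0 := sub_ne_zero.2 h5'
  have h7 : ‖(ε : ℂ) / (x - a) - ε / (x' - a)‖ ≤ ε * ‖x - x'‖ := by
    have h8 : (ε : ℂ) / (x - a) - ε / (x' - a) = ε * (x' - x) / ((x - a) * (x' - a)) := by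
      field_simp; ring
    rw [h8, norm_div, norm_mul, norm_mul, Complex.norm_real, Real.norm_of_nonneg hε0.le,
      norm_sub_rev x' x]
    exact div_le_self (by positivity) (one_le_mul_of_one_le_of_one_le h4 h4')
  have h9 : ‖y - y'‖ - ε * ‖x - x'‖ ≤ ‖y + ε / (x - a) - (y' + ε / (x' - a))‖ := by
    have h10 : y - y' = (y + ε / (x - a) - (y' + ε / (x' - a))) -
      ((ε : ℂ) / (x - a) - ε / (x' - a)) := by ring
    have h11 := norm_sub_le (y + ε / (x - a) - (y' + ε / (x' - a)))
      ((ε : ℂ) / (x - a) - ε / (x' - a))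
    rw [← h10] at h11
    linarith
  simp only [dist_eq_norm, Prod.mk_sub_mk, Prod.norm_mk]
  have hx0 := norm_nonneg (x - x')
  have hy0 := norm_nonneg (y - y')
  rcases le_total ‖x - x'‖ ‖y - y'‖ with hle | hle
  · rw [max_eq_right hle]
    refine le_trans ?_ (le_max_left _ _)
    nlinarith
  · rw [max_eq_left hle]
    refine le_trans ?_ (le_max_right _ _)
    nlinarith

/-- The next shear keeps the points outside the bidisc of radius `Rₙ` almost outside it. -/
lemma norm_gamma_succ_ge (h : IsConstruction s) {n : ℕ} {z : OnePoint ℂ} (hz : z ∈ domain s n)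
    (hz' : z ∉ domain s (n + 1)) : (s n).R - eps (n + 1) ≤ ‖gamma s (n + 1) z‖ := by
  obtain ⟨x', y', h1, -, -⟩ := notMem_exterior.1 hz'
  have hfin : (s n).F z ≠ ∞ := by
    intro hi
    rw [(h.succ n).F_eq, Function.comp_apply, hi, henon_infty] at h1
    exact OnePoint.infty_ne_coe _ h1
  obtain ⟨⟨x, y⟩, hxy⟩ := OnePoint.ne_infty_iff_exists.1 hfin
  have hxa : x ≠ (((s n).R + 1 : ℝ) : ℂ) := by
    intro hxa
    rw [(h.succ n).F_eq, Function.comp_apply, ← hxy, hxa, henon_self] at h1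
    exact OnePoint.infty_ne_coe _ h1
  have hF : (s (n + 1)).F z = ((y + eps (n + 1) / (x - (((s n).R + 1 : ℝ) : ℂ)), x) : ℂ × ℂ) := by
    rw [(h.succ n).F_eq, Function.comp_apply, ← hxy, henon_of_ne hxa]
  have hε := eps_pos (n + 1)
  rw [h.gamma_eq hF, norm_parity, Prod.norm_def]
  dsimp only
  by_cases hx : ‖x‖ ≤ (s n).R
  · refine le_trans ?_ (le_max_left _ _)
    have hy : (s n).R < ‖y‖ := (mem_exterior.1 hz x y hxy.symm).resolve_left hx.not_gt
    have h2 := norm_step_le hx hε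
    have h3 := norm_sub_le (y + eps (n + 1) / (x - (((s n).R + 1 : ℝ) : ℂ)))
      (eps (n + 1) / (x - (((s n).R + 1 : ℝ) : ℂ)))
    rw [add_sub_cancel_right] at h3
    linarith
  · refine le_trans ?_ (le_max_right _ _)
    linarith

/-! ### The limit map -/

lemma notMem_of_le (h : IsConstruction s) {m n : ℕ} (hmn : m ≤ n) {z : OnePoint ℂ}
    (hz : z ∉ domain s m) : z ∉ domain s n := fun hn => hz (h.antitone_domain hmn hn)

lemma dist_gamma_geometric (h : IsConstruction s) {m : ℕ} {z : OnePoint ℂ} (hz : z ∉ domain s m)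
    (k : ℕ) : dist (gamma s (k + m) z) (gamma s (k + 1 + m) z) ≤ (1 / 2) ^ (m + 3) * (1 / 2) ^ k := by
  have h1 := h.dist_gamma_succ (h.notMem_of_le (Nat.le_add_left m k) hz)
  rw [show k + 1 + m = k + m + 1 by ring]
  refine h1.trans (le_of_eq ?_)
  rw [eps, ← pow_add]
  congr 1
  ring

lemma tendsto_gamma (h : IsConstruction s) {m : ℕ} {z : OnePoint ℂ} (hz : z ∉ domain s m) :
    Tendsto (fun n => gamma s n z) atTop (𝓝 (limitMap s z)) := by
  have hc := cauchySeq_of_le_geometric (f := fun k => gamma s (k + m) z) _ _ (by norm_num)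
    (h.dist_gamma_geometric hz)
  obtain ⟨L, hL⟩ := cauchySeq_tendsto_of_complete hc
  exact tendsto_nhds_limUnder ⟨L, (tendsto_add_atTop_iff_nat m).1 hL⟩

lemma dist_gamma_limitMap (h : IsConstruction s) {m : ℕ} {z : OnePoint ℂ} (hz : z ∉ domain s m) :
    dist (gamma s m z) (limitMap s z) ≤ (1 / 2) ^ (m + 2) := by
  have h1 := dist_le_of_le_geometric_of_tendsto₀ (f := fun k => gamma s (k + m) z) _ _
    (by norm_num) (h.dist_gamma_geometric hz)
    ((tendsto_add_atTop_iff_nat m).2 (h.tendsto_gamma hz))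
  simp only [zero_add] at h1
  refine h1.trans (le_of_eq ?_)
  rw [pow_succ _ (m + 2)]
  ring

/-- The maps `γₙ`, `n ≥ m`, and their limit, are obtained from `γₘ` on the complement of `Δₘ` by
post-composition with maps which contract distances at most by the factor `2`. -/
lemma dist_le_two_mul_dist_limitMap (h : IsConstruction s) {m : ℕ} {z w : OnePoint ℂ}
    (hz : z ∉ domain s m) (hw : w ∉ domain s m) :
    dist (gamma s m z) (gamma s m w) ≤ 2 * dist (limitMap s z) (limitMap s w) := by
  -- the factors `1 - εₙ` are absorbed by the decreasing sequence `1 + 2⁻ᵏ`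
  have key : ∀ k, (1 + (1 / 2 : ℝ) ^ k) * dist (gamma s m z) (gamma s m w) ≤
      2 * dist (gamma s (k + m) z) (gamma s (k + m) w) := by
    intro k
    induction k with
    | zero => norm_num
    | succ k ih =>
      have h1 := h.dist_gamma_succ_ge (h.notMem_of_le (Nat.le_add_left m k) hz)
        (h.notMem_of_le (Nat.le_add_left m k) hw)
      rw [show k + 1 + m = k + m + 1 by ring]
      set d₀ := dist (gamma s m z) (gamma s m w)
      set d := dist (gamma s (k + m) z) (gamma s (k + m) w)
      set d' := dist (gamma s (k + m + 1) z) (gamma s (k + m + 1) w)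
      have hd₀ : 0 ≤ d₀ := dist_nonneg
      set q : ℝ := (1 / 2) ^ k with hq
      have hq0 : 0 < q := by positivity
      have hq1 : q ≤ 1 := pow_le_one₀ (by norm_num) (by norm_num)
      have hε : eps (k + m + 1) ≤ q / 8 := by
        have : (1 / 2 : ℝ) ^ m ≤ 1 := pow_le_one₀ (by norm_num) (by norm_num)
        rw [eps, show k + m + 1 + 2 = k + (m + 3) by ring, pow_add, ← hq, pow_add]
        nlinarith
      have hε1 := eps_le_one (k + m + 1)
      have h2 : (1 - eps (k + m + 1)) * ((1 + q) * d₀) ≤ (1 - eps (k + m + 1)) * (2 * d) :=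
        mul_le_mul_of_nonneg_left ih (by linarith)
      have h3 : (1 + q * (1 / 2)) ≤ (1 - eps (k + m + 1)) * (1 + q) := by nlinarith
      have h4 := mul_le_mul_of_nonneg_right h3 hd₀
      rw [pow_succ, ← hq]
      linarith
  have ht : ∀ {z}, z ∉ domain s m → Tendsto (fun k => gamma s (k + m) z) atTop
      (𝓝 (limitMap s z)) := fun hz => (tendsto_add_atTop_iff_nat m).2 (h.tendsto_gamma hz)
  refine ge_of_tendsto' (((ht hz).dist (ht hw)).const_mul 2) fun k => le_trans ?_ (key k)
  have : (0 : ℝ) ≤ (1 / 2) ^ k * dist (gamma s m z) (gamma s m w) := by positivity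
  linarith

lemma norm_limitMap_ge (h : IsConstruction s) {n : ℕ} {z : OnePoint ℂ} (hz : z ∈ domain s n)
    {k : ℕ} (hk : z ∉ domain s k) : (s n).R - 1 ≤ ‖limitMap s z‖ := by
  have hnk : n ≤ k := by
    by_contra hcon
    exact hk (h.antitone_domain (not_le.1 hcon).le hz)
  induction k, hnk using Nat.le_induction with
  | base => exact (hk hz).elim
  | succ k hnk ih =>
    by_cases hzk : z ∈ domain s k
    · have hR : (s n).R ≤ (s k).R :=
        monotone_nat_of_le_succ (f := fun n => (s n).R)
          (fun j => by linarith [(h.succ j).R_le]) hnk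
      have h1 := h.norm_gamma_succ_ge hzk hk
      have h2 := h.dist_gamma_limitMap hk
      rw [dist_eq_norm] at h2
      have h3 := norm_sub_norm_le (gamma s (k + 1) z) (limitMap s z)
      have h4 := eps_le_one (k + 1)
      have h5 : (1 / 2 : ℝ) ^ (k + 1 + 2) ≤ 1 / 4 := eps_le_one (k + 1)
      linarith
    · exact ih hzk

/-- The Cantor set of the construction. -/
def cantor (s : ∀ n, StageData n) : Set (OnePoint ℂ) := ⋂ n, domain s n

lemma mem_compl_cantor {z : OnePoint ℂ} : z ∈ (cantor s)ᶜ ↔ ∃ n, z ∉ domain s n := by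
  simp [cantor]

lemma mem_compl_cantor_of_notMem {z : OnePoint ℂ} {n : ℕ} (hz : z ∉ domain s n) : z ∈ (cantor s)ᶜ :=
  mem_compl_cantor.2 ⟨n, hz⟩

lemma isClosed_cantor (h : IsConstruction s) : IsClosed (cantor s) := by
  rw [← isOpen_compl_iff, isOpen_iff_mem_nhds]
  intro z hz
  obtain ⟨n, hn⟩ := mem_compl_cantor.1 hz
  exact mem_of_superset (h.compl_domain_succ_mem_nhds hn) fun w hw => mem_compl_cantor_of_notMem hw

lemma tendstoLocallyUniformlyOn (h : IsConstruction s) :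
    TendstoLocallyUniformlyOn (gamma s) (limitMap s) atTop (cantor s)ᶜ := by
  rw [Metric.tendstoLocallyUniformlyOn_iff]
  intro ε hε z hz
  obtain ⟨m, hm⟩ := mem_compl_cantor.1 hz
  refine ⟨_, mem_nhdsWithin_of_mem_nhds (h.compl_domain_succ_mem_nhds hm), ?_⟩
  have hlim : Tendsto (fun n : ℕ => (1 / 2 : ℝ) ^ (n + 2)) atTop (𝓝 0) :=
    (tendsto_add_atTop_iff_nat 2).2 (tendsto_pow_atTop_nhds_zero_of_lt_one (by norm_num)
      (by norm_num))
  filter_upwards [hlim.eventually_lt_const hε, eventually_ge_atTop (m + 1)] with n hn hmn w hw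
  rw [dist_comm]
  exact (h.dist_gamma_limitMap (h.notMem_of_le hmn hw)).trans_lt hn

lemma F_ne_infty {n : ℕ} {z : OnePoint ℂ} (hz : z ∉ domain s n) : (s n).F z ≠ ∞ :=
  fun hi => hz (mem_exterior_of_eq_infty hi)

lemma infty_mem_cantor (s : ∀ n, StageData n) : (∞ : OnePoint ℂ) ∈ cantor s :=
  mem_iInter.2 fun n => mem_exterior_of_eq_infty (s n).isStage.map_infty

/-- Poles are never lost. -/
lemma F_eq_infty_of_le (h : IsConstruction s) {m n : ℕ} (hmn : m ≤ n) {z : OnePoint ℂ}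
    (hz : (s m).F z = ∞) : (s n).F z = ∞ := by
  induction n, hmn using Nat.le_induction with
  | base => exact hz
  | succ n _ ih => rw [(h.succ n).F_eq, Function.comp_apply, ih, henon_infty]

lemma pole_mem_cantor (h : IsConstruction s) {m : ℕ} {z : OnePoint ℂ} (hz : (s m).F z = ∞) :
    z ∈ cantor s := by
  refine mem_iInter.2 fun n => ?_
  rcases le_total m n with hmn | hmn
  · exact mem_exterior_of_eq_infty (h.F_eq_infty_of_le hmn hz)
  · exact h.antitone_domain hmn (mem_exterior_of_eq_infty hz)

lemma F_ne_infty_of_mem_compl (h : IsConstruction s) (n : ℕ) {z : OnePoint ℂ}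
    (hz : z ∈ (cantor s)ᶜ) : (s n).F z ≠ ∞ := fun hi => hz (h.pole_mem_cantor hi)

lemma exists_hasDerivAt_gamma (h : IsConstruction s) {n : ℕ} {ζ : ℂ} (hζ : (s n).F ζ ≠ ∞) :
    ∃ d : ℂ × ℂ, d ≠ 0 ∧ HasDerivAt (fun w : ℂ => gamma s n w) d ζ := by
  obtain ⟨x, y, x', y', hF, hx, hy, h0⟩ := (s n).isStage.regular ζ hζ
  by_cases hn : Even n
  · refine ⟨(x', y'), by simpa [Prod.ext_iff] using h0,
      (hx.prodMk hy).congr_of_eventuallyEq ?_⟩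
    filter_upwards [hF] with w hw
    rw [h.gamma_eq hw]; simp [parity, hn]
  · refine ⟨(y', x'), by simpa [Prod.ext_iff, and_comm] using h0,
      (hy.prodMk hx).congr_of_eventuallyEq ?_⟩
    filter_upwards [hF] with w hw
    rw [h.gamma_eq hw]; simp [parity, hn]

lemma isOpen_preimage_compl_cantor (h : IsConstruction s) :
    IsOpen {z : ℂ | (z : OnePoint ℂ) ∈ (cantor s)ᶜ} :=
  h.isClosed_cantor.isOpen_compl.preimage continuous_coe

lemma differentiableOn_limitMap (h : IsConstruction s) :
    DifferentiableOn ℂ (fun z : ℂ => limitMap s z) {z | (z : OnePoint ℂ) ∈ (cantor s)ᶜ} := by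
  have hu := h.tendstoLocallyUniformlyOn.comp ((↑) : ℂ → OnePoint ℂ)
    (t := {z : ℂ | (z : OnePoint ℂ) ∈ (cantor s)ᶜ}) (fun z hz => hz) continuous_coe.continuousOn
  refine hu.differentiableOn (Eventually.of_forall fun n z hz => ?_) h.isOpen_preimage_compl_cantor
  obtain ⟨d, -, hd⟩ := h.exists_hasDerivAt_gamma (h.F_ne_infty_of_mem_compl n hz)
  exact hd.differentiableAt.differentiableWithinAt

lemma differentiableAt_limitMap (h : IsConstruction s) {ζ : ℂ}
    (hζ : (ζ : OnePoint ℂ) ∈ (cantor s)ᶜ) :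
    DifferentiableAt ℂ (fun z : ℂ => limitMap s z) ζ :=
  h.differentiableOn_limitMap.differentiableAt (h.isOpen_preimage_compl_cantor.mem_nhds hζ)

lemma deriv_limitMap_ne_zero (h : IsConstruction s) {ζ : ℂ}
    (hζ : (ζ : OnePoint ℂ) ∈ (cantor s)ᶜ) : deriv (fun z : ℂ => limitMap s z) ζ ≠ 0 := by
  intro h0
  obtain ⟨m, hm⟩ := mem_compl_cantor.1 hζ
  have hm' : (ζ : OnePoint ℂ) ∉ domain s (m + 1) := h.notMem_of_le m.le_succ hm
  obtain ⟨d, hd0, hd⟩ := h.exists_hasDerivAt_gamma (F_ne_infty hm')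
  have hl := (h.differentiableAt_limitMap hζ).hasDerivAt
  rw [h0, hasDerivAt_iff_isLittleO] at hl
  -- the increments of `γₘ₊₁` are dominated by those of the limit, so its derivative would vanish
  refine hd0 (hd.unique ?_)
  rw [hasDerivAt_iff_isLittleO]
  simp only [smul_zero, sub_zero] at hl ⊢
  refine Asymptotics.IsBigO.trans_isLittleO (Asymptotics.IsBigO.of_bound 2 ?_) hl
  filter_upwards [continuous_coe.continuousAt.preimage_mem_nhds
    (h.compl_domain_succ_mem_nhds hm)] with w hw
  simpa only [dist_eq_norm] using h.dist_le_two_mul_dist_limitMap hw hm'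

lemma eq_of_gamma_eq (h : IsConstruction s) {n : ℕ} {z w : OnePoint ℂ} (hz : (s n).F z ≠ ∞)
    (hw : (s n).F w ≠ ∞) (heq : gamma s n z = gamma s n w) : z = w := by
  obtain ⟨p, hp⟩ := OnePoint.ne_infty_iff_exists.1 hz
  obtain ⟨q, hq⟩ := OnePoint.ne_infty_iff_exists.1 hw
  rw [h.gamma_eq (x := p.1) (y := p.2) hp.symm, h.gamma_eq (x := q.1) (y := q.2) hq.symm,
    ← dist_eq_zero, dist_parity, dist_eq_zero] at heq
  have hpq : p = q := heq
  exact (s n).isStage.inj z w (by rw [← hp, ← hq, hpq]) hz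

lemma injOn_limitMap (h : IsConstruction s) : InjOn (limitMap s) (cantor s)ᶜ := by
  intro z hz w hw heq
  obtain ⟨m, hm⟩ := mem_compl_cantor.1 hz
  obtain ⟨m', hm'⟩ := mem_compl_cantor.1 hw
  have h1 := h.notMem_of_le (le_max_left m m') hm
  have h2 := h.notMem_of_le (le_max_right m m') hm'
  have h3 := h.dist_le_two_mul_dist_limitMap h1 h2
  rw [heq, dist_self, mul_zero] at h3
  exact h.eq_of_gamma_eq (F_ne_infty h1) (F_ne_infty h2) (dist_le_zero.1 h3)

lemma tendsto_radius (h : IsConstruction s) : Tendsto (radius s) atTop atTop := by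
  have hle : ∀ n : ℕ, (n : ℝ) ≤ radius s n := by
    intro n
    induction n with
    | zero => simpa [radius] using (s 0).R_pos.le
    | succ n ih =>
      have := (h.succ n).R_le
      unfold radius at *
      push_cast; linarith
  exact tendsto_atTop_mono hle tendsto_natCast_atTop_atTop

lemma continuousOn_limitMap (h : IsConstruction s) : ContinuousOn (limitMap s) (cantor s)ᶜ := by
  intro z hz
  induction z using OnePoint.rec with
  | infty => exact (hz (infty_mem_cantor s)).elim
  | coe ζ =>
    exact (OnePoint.continuousAt_coe.2
      (h.differentiableAt_limitMap hz).continuousAt).continuousWithinAt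

lemma isProperMap_limitMap (h : IsConstruction s) :
    IsProperMap ((cantor s)ᶜ.domRestrict (limitMap s)) := by
  have hcont : Continuous ((cantor s)ᶜ.domRestrict (limitMap s)) :=
    continuousOn_iff_continuous_domRestrict.1 h.continuousOn_limitMap
  refine isProperMap_iff_isCompact_preimage.2 ⟨hcont, fun K hK => ?_⟩
  obtain ⟨M, hM⟩ := hK.isBounded.exists_norm_le
  obtain ⟨n, hn⟩ := (h.tendsto_radius.eventually_gt_atTop (M + 1)).exists
  have hn' : M + 1 < (s n).R := hn
  have hcomp : IsCompact (((↑) : ((cantor s)ᶜ : Set (OnePoint ℂ)) → OnePoint ℂ) ⁻¹'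
      (domain s n)ᶜ) := by
    rw [Topology.IsInducing.subtypeVal.isCompact_preimage_iff]
    · exact (isOpen_domain n).isClosed_compl.isCompact
    · rw [Subtype.range_coe]
      exact fun z hz => mem_compl_cantor_of_notMem hz
  refine hcomp.of_isClosed_subset (hK.isClosed.preimage hcont) fun z hz hzn => ?_
  obtain ⟨k, hk⟩ := mem_compl_cantor.1 z.2
  have h1 := h.norm_limitMap_ge hzn hk
  have h2 : ‖limitMap s z‖ ≤ M := hM _ hz
  linarith

theorem isProperHolomorphicEmbeddingOn (h : IsConstruction s) :
    IsProperHolomorphicEmbeddingOn (cantor s)ᶜ (limitMap s) := by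
  have hinv : ∀ w : ℂ, invChart w ∈ (cantor s)ᶜ → w ≠ 0 ∧ ((w⁻¹ : ℂ) : OnePoint ℂ) ∈ (cantor s)ᶜ ∧
      HasDerivAt (fun w => limitMap s (invChart w))
        (-(w ^ 2)⁻¹ • deriv (fun z : ℂ => limitMap s z) w⁻¹) w := by
    intro w hw
    have hw0 : w ≠ 0 := by
      rintro rfl
      rw [invChart_zero] at hw
      exact hw (infty_mem_cantor s)
    have hw' : ((w⁻¹ : ℂ) : OnePoint ℂ) ∈ (cantor s)ᶜ := by rwa [invChart_of_ne hw0] at hw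
    refine ⟨hw0, hw', ?_⟩
    refine ((h.differentiableAt_limitMap hw').hasDerivAt.scomp w
      (hasDerivAt_inv hw0)).congr_of_eventuallyEq ?_
    filter_upwards [isOpen_ne.mem_nhds hw0] with v hv
    rw [invChart_of_ne hv]; rfl
  refine ⟨⟨h.isClosed_cantor.isOpen_compl, h.differentiableOn_limitMap, fun w hw => ?_⟩,
    ⟨fun z hz => h.deriv_limitMap_ne_zero hz, fun w hw => ?_⟩, ?_, h.isProperMap_limitMap⟩
  · exact (hinv w hw).2.2.differentiableAt.differentiableWithinAt
  · obtain ⟨hw0, hw', hd⟩ := hinv w hw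
    rw [hd.deriv]
    exact smul_ne_zero (neg_ne_zero.2 (inv_ne_zero (pow_ne_zero 2 hw0)))
      (h.deriv_limitMap_ne_zero hw')
  · exact (IsClosedEmbedding.of_continuous_injective_isClosedMap
      h.isProperMap_limitMap.continuous (injOn_iff_injective.1 h.injOn_limitMap)
      h.isProperMap_limitMap.isClosedMap).isEmbedding

end IsConstruction

end ShearConstruction

namespace ShearConstruction.IsConstruction

variable {s : ∀ n, StageData n}

/-! ### The limit set is a Cantor set of dimension zero -/

lemma mem_domain_of_mem_cantor {z : OnePoint ℂ} (hz : z ∈ cantor s) (n : ℕ) : z ∈ domain s n :=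
  mem_iInter.1 hz n

lemma tendsto_b : Tendsto b atTop atTop :=
  (Nat.fib_add_two_strictMono).tendsto_atTop

lemma tendsto_mesh : Tendsto mesh atTop (𝓝 0) := by
  have h1 : Tendsto (fun n => 1 / (b n : ℝ)) atTop (𝓝 0) :=
    tendsto_one_div_atTop_nhds_zero_nat.comp tendsto_b
  refine squeeze_zero' (Eventually.of_forall fun n => (mesh_pos n).le) ?_ h1
  filter_upwards [eventually_ge_atTop 1] with n hn
  have hb : (1 : ℝ) ≤ b n := by exact_mod_cast b_pos n
  have h2 : (b n : ℝ) ≤ (b n : ℝ) ^ n := le_self_pow₀ hb (by omega)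
  exact (mesh_lt n).le.trans (one_div_le_one_div_of_le (by linarith) h2)

lemma isCompact_cantor (h : IsConstruction s) : IsCompact (cantor s) := h.isClosed_cantor.isCompact

/-- The limit set has no isolated point: `z` is near a pole of `γₙ`, and a pole is near another
one. -/
lemma exists_ne_near (h : IsConstruction s) {z : OnePoint ℂ} (hz : z ∈ cantor s) (n : ℕ) :
    ∃ w ∈ cantor s, w ≠ z ∧ sphDist w z ≤ max (mesh n) (mesh (n + 1)) := by
  -- next to a pole of the first coordinate there is a pole of the next map; a pole of the second
  -- coordinate becomes one of the first coordinate after one more step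
  have hX : ∀ k, ∀ p ∈ (s k).PX, ∃ w ∈ cantor s, w ≠ p ∧ sphDist w p ≤ mesh k := by
    intro k p hp
    obtain ⟨q, hq, hqp, hqN⟩ := (h.succ k).new_pole p hp
    exact ⟨q, h.pole_mem_cantor (((s (k + 1)).isStage.eq_infty_iff q).2 (Or.inl hq)), hqp,
      (s k).isSeparation.small p (Or.inl hp) q hqN.1 p ((s k).isSeparation.mem (Or.inl hp))⟩
  obtain ⟨p, hp, hzp⟩ := (s n).isSeparation.cover z (mem_domain_of_mem_cantor hz n)
  by_cases hpz : p = z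
  · subst hpz
    rcases hp with hp | hp
    · obtain ⟨w, h1, h2, h3⟩ := hX n p hp
      exact ⟨w, h1, h2, h3.trans (le_max_left _ _)⟩
    · obtain ⟨w, h1, h2, h3⟩ := hX (n + 1) p ((h.succ n).PX_sub hp)
      exact ⟨w, h1, h2, h3.trans (le_max_right _ _)⟩
  · exact ⟨p, h.pole_mem_cantor (((s n).isStage.eq_infty_iff p).2 hp), hpz,
      ((s n).isSeparation.small p hp p ((s n).isSeparation.mem hp) z hzp).trans (le_max_left _ _)⟩

lemma subsingleton_of_isPreconnected {S : Set (OnePoint ℂ)}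
    (hS : IsPreconnected S) (hsub : S ⊆ cantor s) : S.Subsingleton := by
  intro z hz w hw
  refine eq_of_sphDist_eq_zero (le_antisymm ?_ (Real.arccos_nonneg _))
  refine ge_of_tendsto' tendsto_mesh fun n => ?_
  obtain ⟨p, hp, hzp⟩ := (s n).isSeparation.cover z (mem_domain_of_mem_cantor (hsub hz) n)
  have h1 := (s n).isSeparation.subset_of_isPreconnected hp hS
    (fun x hx => mem_domain_of_mem_cantor (hsub hx) n) ⟨z, hz, hzp⟩
  exact (s n).isSeparation.small p hp z hzp w (h1 hw)

theorem isCantorSet_cantor (h : IsConstruction s) : IsCantorSet (cantor s) := by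
  have : CompactSpace (cantor s) := isCompact_iff_compactSpace.1 h.isCompact_cantor
  have : Nonempty (cantor s) := ⟨⟨∞, infty_mem_cantor s⟩⟩
  have : TotallyDisconnectedSpace (cantor s) :=
    totallyDisconnectedSpace_subtype_iff.2 fun S hS hS' => subsingleton_of_isPreconnected hS' hS
  let := sphMetric
  have : SecondCountableTopology (OnePoint ℂ) := inferInstance
  have hperf : ∀ x : cantor s, (𝓝[≠] x).NeBot := by
    intro x
    rw [← mem_closure_iff_nhdsWithin_neBot, Metric.mem_closure_iff]
    intro ε hε
    have hlim := tendsto_mesh.max ((tendsto_add_atTop_iff_nat 1).2 tendsto_mesh)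
    rw [max_self] at hlim
    obtain ⟨n, hn⟩ := (hlim.eventually_lt_const hε).exists
    obtain ⟨w, hw, hwx, hd⟩ := h.exists_ne_near x.2 n
    refine ⟨⟨w, hw⟩, fun heq => hwx (congrArg Subtype.val heq), ?_⟩
    rw [dist_comm]
    exact hd.trans_lt hn
  obtain ⟨e⟩ := nonempty_homeomorph_nat_bool hperf
  exact ⟨e.trans cantorSetHomeomorphNatToBool.symm⟩

open Classical in
/-- The finite set of all the poles of `γₙ`. -/
noncomputable def poleSet (s : ∀ n, StageData n) (n : ℕ) : Finset (OnePoint ℂ) :=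
  (s n).PX ∪ (s n).PY

lemma mem_poleSet {n : ℕ} {z : OnePoint ℂ} :
    z ∈ poleSet s n ↔ z ∈ (s n).PX ∨ z ∈ (s n).PY := by
  classical exact Finset.mem_union

lemma card_poleSet (n : ℕ) : (poleSet s n).card = b n := by
  classical
  rw [poleSet, Finset.card_union_of_disjoint (s n).isStage.disjoint, (s n).isStage.card_fst,
    (s n).isStage.card_snd, b, Nat.fib_add_two, add_comm]

theorem sphDimH_cantor (s : ∀ n, StageData n) : sphDimH (cantor s) = 0 := by
  let := sphMetric
  refine dimH_eq_zero_of_cover (P := poleSet s) (t := fun n p => (s n).N p)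
    ?_ (Eventually.of_forall fun n z hz => ?_) (Eventually.of_forall fun n p hp => ?_)
  · simpa only [card_poleSet] using tendsto_b
  · obtain ⟨p, hp, hzp⟩ := (s n).isSeparation.cover z (mem_domain_of_mem_cantor hz n)
    exact mem_biUnion (x := p) (Finset.mem_coe.2 (mem_poleSet.2 hp)) hzp
  · refine Metric.ediam_le fun x hx y hy => ?_
    have h1 := (s n).isSeparation.small p (mem_poleSet.1 hp) x hx y hy
    have hb : (0 : ℝ) < b n := by exact_mod_cast b_pos n
    rw [card_poleSet, edist_dist, ← ENNReal.ofReal_natCast, ← ENNReal.ofReal_inv_of_pos hb,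
      ← ENNReal.ofReal_pow (by positivity)]
    refine ENNReal.ofReal_le_ofReal (h1.trans ((mesh_lt n).le.trans (le_of_eq ?_)))
    rw [one_div, inv_pow]

/-! ### Conclusion -/

lemma isParameterSystem (h : IsConstruction s) :
    IsParameterSystem (center s) eps (radius s) where
  eps_pos n _ := eps_pos n
  eps_lt n _ := pow_lt_pow_right_of_lt_one₀ (by norm_num) (by norm_num) (by omega)
  eps_tendsto := (tendsto_add_atTop_iff_nat 2).2
    (tendsto_pow_atTop_nhds_zero_of_lt_one (by norm_num) (by norm_num))
  R_pos n := (s n).R_pos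
  R_strictMono := strictMono_nat_of_lt_succ fun n => by
    have := (h.succ n).R_le
    unfold radius; linarith
  R_tendsto := h.tendsto_radius
  R_lt_norm n := by
    rw [center, Nat.add_sub_cancel, norm_add_one (s n).R_pos]
    unfold radius; linarith
  norm_lt_R n := by
    have := (h.succ n).R_le
    rw [center, Nat.add_sub_cancel, norm_add_one (s n).R_pos]
    unfold radius; linarith

lemma cantor_eq (h : IsConstruction s) :
    cantor s = ⋂ n ∈ Ici 1, Delta (center s) eps (radius s) n := by
  simp only [h.delta_eq]
  refine Subset.antisymm (subset_iInter₂ fun n _ => iInter_subset _ n) fun z hz => ?_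
  refine mem_iInter.2 fun n => h.domain_succ_subset n ?_
  exact mem_iInter₂.1 hz (n + 1) (mem_Ici.2 (Nat.le_add_left 1 n))

lemma mem_poles (h : IsConstruction s) {n : ℕ} {z : OnePoint ℂ} :
    z ∈ poles (center s) eps n ↔ (s n).F z = ∞ := h.gammaSeq_eq_infty

end ShearConstruction.IsConstruction

open RiemannSphere ShearConstruction in
theorem theorem1p1 :
    ∃ (a : ℕ → ℂ) (ε R : ℕ → ℝ) (C : Set (OnePoint ℂ)) (γ : OnePoint ℂ → ℂ × ℂ),
      IsParameterSystem a ε R ∧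
      IsCantorSet C ∧
      sphDimH C = 0 ∧
      IsProperHolomorphicEmbeddingOn Cᶜ γ ∧
      C = ⋂ n ∈ Set.Ici 1, Delta a ε R n ∧
      (∀ n, 1 ≤ n →
        (poles a ε n).ncard = b n ∧
        poles a ε n ⊆ C ∧
        IsOpen (Delta a ε R n) ∧
        ∀ z ∈ Delta a ε R n,
          (∃! p, p ∈ connectedComponentIn (Delta a ε R n) z ∧ p ∈ poles a ε n) ∧
          sphDiam (connectedComponentIn (Delta a ε R n) z) < 1 / (b n : ℝ) ^ n) ∧
      TendstoLocallyUniformlyOn (fun n z => finitePart (gammaSeq a ε n z)) γ atTop Cᶜ := by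
  obtain ⟨s, h0, hs⟩ := exists_stageData
  have h : IsConstruction s := ⟨h0, hs⟩
  refine ⟨center s, eps, radius s, IsConstruction.cantor s, limitMap s, h.isParameterSystem,
    h.isCantorSet_cantor, IsConstruction.sphDimH_cantor s, h.isProperHolomorphicEmbeddingOn,
    h.cantor_eq, fun n _ => ⟨?_, ?_, ?_, ?_⟩, h.tendstoLocallyUniformlyOn⟩
  · have : poles (center s) eps n = (IsConstruction.poleSet s n : Set (OnePoint ℂ)) := by
      ext z
      rw [h.mem_poles, (s n).isStage.eq_infty_iff, Finset.mem_coe, IsConstruction.mem_poleSet]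
    rw [this, ncard_coe_finset, IsConstruction.card_poleSet]
  · exact fun z hz => h.pole_mem_cantor (h.mem_poles.1 hz)
  · rw [h.delta_eq]
    exact IsConstruction.isOpen_domain n
  · intro z hz
    rw [h.delta_eq] at hz ⊢
    obtain ⟨h1, h2⟩ := (s n).isSeparation.existsUnique_pole (s n).isStage.eq_infty_iff hz
    simp only [h.mem_poles]
    exact ⟨h1, h2.trans_lt (mesh_lt n)⟩
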